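/- For a countable language $L$ let $\mathrm{Str}_L$ be the space of all $L$-structures with universe $\omega$, with its natural (product) topology. For a countable set $\Phi$ of sentences of $L_{\omega_1\omega}$ let $\mathrm{Mod}(\Phi)\subseteq \mathrm{Str}_L$ be the set of models of $\Phi$ with universe $\omega$. If $\Phi$, $\Phi'$ are countable sets of $L_{\omega_1\omega}$-, respectively $L'_{\omega_1\omega}$-sentences in countable languages $L$, $L'$, write $\Phi\le_B \Phi'$ if there is a Borel function $f:\mathrm{Mod}(\Phi)\to \mathrm{Mod}(\Phi')$ such that for all $M,N\in \mathrm{Mod}(\Phi)$, $f(M)\cong f(N)$ if and only if $M\cong N$. The theory $\Phi$ is called \emph{Borel complete} if $\Phi'\le_B \Phi$ for every countable set $\Phi'$ of $L'_{\omega_1\omega}$-sentences in any countable language $L'$. Let $R$ be a countable ring with unit, $1\neq 0$, not necessarily commutative. Consider the language with symbols $0$, $+$, a unary function symbol for multiplication by each $r\in R$, and one more unary function symbol $T$. Then the theory, in this language, of left $R$-endomorphism structures, that is, of pairs $(V,T)$ where $V$ is a left $R$-module and $T:V\to V$ is an $R$-module endomorphism, is Borel complete. -/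

import Mathlib

namespace BorelModules

universe u v u' v' w

/-! ### The infinitary logic with countable conjunctions and finitary quantifiers -/

/-- Formulas of `L_{ω₁ω}` with free variables indexed by `Fin n`.  The other connectives (negation,
countable disjunction, existential quantification) are obtained from these classically. -/
inductive InfFormula (L : FirstOrder.Language.{u, v}) : ℕ → Type (max u v)
  | falsum {n : ℕ} : InfFormula L n
  | equal {n : ℕ} (s t : L.Term (Fin n)) : InfFormula L n
  | rel {n k : ℕ} (r : L.Relations k) (ts : Fin k → L.Term (Fin n)) : InfFormula L n
  | imp {n : ℕ} (φ ψ : InfFormula L n) : InfFormula L n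
  | iConj {n : ℕ} (φ : ℕ → InfFormula L n) : InfFormula L n
  | all {n : ℕ} (φ : InfFormula L (n + 1)) : InfFormula L n

/-- Sentences of `L_{ω₁ω}`. -/
abbrev InfSentence (L : FirstOrder.Language.{u, v}) : Type (max u v) := InfFormula L 0

namespace InfFormula

variable {L : FirstOrder.Language.{u, v}}

/-- Tarskian satisfaction of an `L_{ω₁ω}` formula at an assignment of its free variables. -/
def Realize {M : Type w} [L.Structure M] : {n : ℕ} → InfFormula L n → (Fin n → M) → Prop
  | _, falsum, _ => False
  | _, equal s t, x => s.realize x = t.realize x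
  | _, rel r ts, x => FirstOrder.Language.Structure.RelMap r (fun i => (ts i).realize x)
  | _, imp φ ψ, x => φ.Realize x → ψ.Realize x
  | _, iConj φ, x => ∀ i, (φ i).Realize x
  | _, all φ, x => ∀ a : M, φ.Realize (Fin.snoc x a)

/-- Negation. -/
def neg {n : ℕ} (φ : InfFormula L n) : InfFormula L n := imp φ falsum

/-- Existential quantification of the last variable. -/
def ex {n : ℕ} (φ : InfFormula L (n + 1)) : InfFormula L n := neg (all (neg φ))

/-- Universal closure. -/
def univClosure : {n : ℕ} → InfFormula L n → InfSentence L
  | 0, φ => φ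
  | _ + 1, φ => univClosure (all φ)

end InfFormula

/-! ### The space of structures with universe `ω` -/

/-- `Str_L`: all `L`-structures with universe `ω`. -/
def Str (L : FirstOrder.Language.{u, v}) : Type (max u v) := L.Structure ℕ

namespace Str

variable {L : FirstOrder.Language.{u, v}}

/-- The natural topology on `Str_L`, i.e. the product topology, where `ω` and the truth values are
discrete. -/
instance : TopologicalSpace (Str L) :=
  TopologicalSpace.generateFrom
    ({U | ∃ (n : ℕ) (f : L.Functions n) (a : Fin n → ℕ) (b : ℕ), U = {S : Str L | S.funMap f a = b}} ∪
     {U | ∃ (n : ℕ) (r : L.Relations n) (a : Fin n → ℕ), U = {S : Str L | S.RelMap r a}} ∪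
     {U | ∃ (n : ℕ) (r : L.Relations n) (a : Fin n → ℕ), U = {S : Str L | ¬ S.RelMap r a}})

/-- The Borel `σ`-algebra of `Str_L`. -/
instance : MeasurableSpace (Str L) := borel (Str L)

instance : BorelSpace (Str L) := ⟨rfl⟩

/-- Isomorphism of `L`-structures with universe `ω`. -/
def Iso (S S' : Str L) : Prop := Nonempty (@FirstOrder.Language.Equiv L ℕ ℕ S S')

/-- `S ⊨ φ` for a sentence `φ` of `L_{ω₁ω}`. -/
def Satisfies (S : Str L) (φ : InfSentence L) : Prop :=
  @InfFormula.Realize L ℕ S 0 φ Fin.elim0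

end Str

/-- `Mod(T)`: the models with universe `ω` of a set `T` of `L_{ω₁ω}` sentences.  As a subtype of `Str_L`
it carries the subspace Borel structure. -/
def Mod {L : FirstOrder.Language.{u, v}} (T : Set (InfSentence L)) : Set (Str L) :=
  {S | ∀ φ ∈ T, S.Satisfies φ}

/-- `T ≤_B T'`: there is a Borel map `Mod(T) → Mod(T')` that preserves and reflects isomorphism. -/
def BorelReducible {L : FirstOrder.Language.{u, v}} {L' : FirstOrder.Language.{u', v'}}
    (T : Set (InfSentence L)) (T' : Set (InfSentence L')) : Prop :=
  ∃ f : Mod T → Mod T', Measurable f ∧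
    ∀ M N : Mod T, Str.Iso (f M).1 (f N).1 ↔ Str.Iso M.1 N.1

/-- `T` is Borel complete: `T` is maximal for Borel reducibility among the countable `L_{ω₁ω}` theories
in countable languages.  (A countable theory amounts to the single sentence that is its conjunction;
every countable language is a renaming of one in the lowest universe.) -/
def BorelComplete {L : FirstOrder.Language.{u, v}} (T : Set (InfSentence L)) : Prop :=
  Countable L.Symbols ∧ T.Countable ∧
    ∀ (L' : FirstOrder.Language.{0, 0}) (T' : Set (InfSentence L')),
      Countable L'.Symbols → T'.Countable → BorelReducible T' T

/-! ### Left `R`-modules with an endomorphism -/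

/-- The function symbols `0`, `+`, scalar multiplication by each `r : R`, and a symbol for the
endomorphism. -/
inductive EndoFunc (R : Type u) : ℕ → Type u
  | zero : EndoFunc R 0
  | add : EndoFunc R 2
  | smul (r : R) : EndoFunc R 1
  | endo : EndoFunc R 1

/-- The language of left `R`-modules with an additional unary function symbol. -/
def endoLang (R : Type u) : FirstOrder.Language.{u, 0} := ⟨EndoFunc R, fun _ => Empty⟩

namespace EndoTerm

variable {R : Type u} {n : ℕ}

/-- The constant `0`. -/
def zero : (endoLang R).Term (Fin n) := .func (EndoFunc.zero : (endoLang R).Functions 0) ![]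

/-- The term `s + t`. -/
def add (s t : (endoLang R).Term (Fin n)) : (endoLang R).Term (Fin n) :=
  .func (EndoFunc.add : (endoLang R).Functions 2) ![s, t]

/-- The term `r · t`. -/
def smul (r : R) (t : (endoLang R).Term (Fin n)) : (endoLang R).Term (Fin n) :=
  .func (EndoFunc.smul r : (endoLang R).Functions 1) ![t]

/-- The term `T(t)`, where `T` is the symbol for the endomorphism. -/
def endo (t : (endoLang R).Term (Fin n)) : (endoLang R).Term (Fin n) :=
  .func (EndoFunc.endo : (endoLang R).Functions 1) ![t]

/-- The variable `x_i`. -/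
def x (i : Fin n) : (endoLang R).Term (Fin n) := .var i

end EndoTerm

open EndoTerm InfFormula in
/-- The axioms of left `R`-endomorphism structures `(V, T)`: `V` is a left `R`-module (first the axioms
of abelian groups, then those of the scalar multiplication) and `T : V → V` is `R`-linear. -/
inductive EndoAxiom (R : Type u) [Ring R] : InfSentence (endoLang R) → Prop
  | add_assoc : EndoAxiom R (univClosure (n := 3)
      (equal (add (add (x 0) (x 1)) (x 2)) (add (x 0) (add (x 1) (x 2)))))
  | add_comm : EndoAxiom R (univClosure (n := 2) (equal (add (x 0) (x 1)) (add (x 1) (x 0))))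
  | add_zero : EndoAxiom R (univClosure (n := 1) (equal (add (x 0) zero) (x 0)))
  | exists_neg : EndoAxiom R (univClosure (n := 1) (ex (n := 1) (equal (add (x 0) (x 1)) zero)))
  | smul_add (r : R) : EndoAxiom R (univClosure (n := 2)
      (equal (smul r (add (x 0) (x 1))) (add (smul r (x 0)) (smul r (x 1)))))
  | add_smul (r s : R) : EndoAxiom R (univClosure (n := 1)
      (equal (smul (r + s) (x 0)) (add (smul r (x 0)) (smul s (x 0)))))
  | mul_smul (r s : R) : EndoAxiom R (univClosure (n := 1)
      (equal (smul (r * s) (x 0)) (smul r (smul s (x 0)))))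
  | one_smul : EndoAxiom R (univClosure (n := 1) (equal (smul 1 (x 0)) (x 0)))
  | endo_add : EndoAxiom R (univClosure (n := 2)
      (equal (endo (add (x 0) (x 1))) (add (endo (x 0)) (endo (x 1)))))
  | endo_smul (r : R) : EndoAxiom R (univClosure (n := 1)
      (equal (endo (smul r (x 0))) (smul r (endo (x 0)))))

/-- The theory of left `R`-endomorphism structures. -/
def endoTheory (R : Type u) [Ring R] : Set (InfSentence (endoLang R)) := {φ | EndoAxiom R φ}

end BorelModules

namespace BorelModules

open Polynomial

/-! ### Sequences as power series with coefficients in a module -/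

section Seq

variable {W : Type*} [AddCommGroup W]

/-! A structure on ω is determined by the set D of its atomic facts, each recorded as a label (a
symbol code and a tuple of numbers), and isomorphism means that some permutation of ℕ carries one
set of labels to the other (`iso_iff_facts`). It suffices to recover D, up to relabelling, from a
module with an endomorphism.

Many submodules are packed into one endomorphism as follows. Given submodules K n of W, let V be the
sum in W[[X]] of the modules K n[X][1/p n], where the p n are monic, pairwise coprime over ℤ and
have constant coefficient 1, and let X act. Constant coefficients recover W as V/XV. Moreover K n is
recovered as well: constants from K n are divisible by every power of p n, while modulo K n only
denominators coprime to p n remain and nothing nonzero is so divisible (`exists_fracSeq_divides`,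
`mem_of_divisible`). Hence an isomorphism of the encodings induces one of the families
(`exists_equiv_of_seqSpace_equiv`).

Now take W = Point →₀ A with A simple, a quotient of R by a maximal left ideal. The points are
reduced words in letters that act almost freely and induce transpositions on labels. The family
consists of the vectors supported on points with label in D, of W itself, and of the invariant hull
`gen v` of every linear map v : A → W. If v is supported at two or more points, its hull contains no
nonzero vector supported at a single point (`noSingle_gen`). An automorphism h that preserves all
hulls must therefore permute the points: otherwise the hull of a ↦ h(single x a) would contain
single x a. The permutation respects everything that the letters respect, so it comes from a
permutation of ℕ on labels (`exists_relabel`). Conversely, each permutation of ℕ lifts, by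
back-and-forth, to a permutation of the points that agrees with a product of letters on each finite
set, and so preserves every hull (`exists_lift`).

Only the first submodule depends on the structure, and all encodings lie in one countable set, so
the encoding can be carried out in a Borel way. -/

/-- Multiplication by the variable on sequences, regarded as power series. -/
def seqShift (W : Type*) [AddCommGroup W] : (ℕ → W) →ₗ[ℤ] (ℕ → W) where
  toFun f n := Nat.casesOn n 0 f
  map_add' f g := by ext n; cases n <;> simp
  map_smul' c f := by ext n; cases n <;> simp

@[simp] theorem seqShift_zero (f : ℕ → W) : seqShift W f 0 = 0 := rfl

@[simp] theorem seqShift_succ (f : ℕ → W) (n : ℕ) : seqShift W f (n + 1) = f n := rfl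

/-- Multiplication of a sequence, regarded as a power series, by an integer polynomial. -/
noncomputable def seqAct (q : ℤ[X]) (f : ℕ → W) : ℕ → W :=
  aeval (R := ℤ) (A := Module.End ℤ (ℕ → W)) (seqShift W) q f

theorem seqAct_mul (p q : ℤ[X]) (f : ℕ → W) : seqAct (p * q) f = seqAct p (seqAct q f) := by
  simp [seqAct]

theorem seqAct_add (p q : ℤ[X]) (f : ℕ → W) : seqAct (p + q) f = seqAct p f + seqAct q f := by
  simp [seqAct]

@[simp] theorem seqAct_one (f : ℕ → W) : seqAct 1 f = f := by
  simp [seqAct]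

@[simp] theorem seqAct_X (f : ℕ → W) : seqAct X f = seqShift W f := by
  simp [seqAct]

@[simp] theorem seqAct_zero (q : ℤ[X]) : seqAct q (0 : ℕ → W) = 0 := map_zero _

theorem seqAct_map_add (q : ℤ[X]) (f g : ℕ → W) : seqAct q (f + g) = seqAct q f + seqAct q g :=
  map_add _ f g

theorem seqAct_map_sub (q : ℤ[X]) (f g : ℕ → W) : seqAct q (f - g) = seqAct q f - seqAct q g :=
  map_sub _ f g

theorem seqShift_pow (k : ℕ) (f : ℕ → W) (n : ℕ) :
    ((seqShift W : Module.End ℤ (ℕ → W)) ^ k) f n = if k ≤ n then f (n - k) else 0 := by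
  induction k generalizing n with
  | zero => simp
  | succ k ih =>
    rw [pow_succ', Module.End.mul_apply]
    cases n with
    | zero => simp
    | succ n => simp [ih]

theorem seqAct_apply (q : ℤ[X]) (f : ℕ → W) (n : ℕ) :
    seqAct q f n = ∑ i ∈ Finset.range (n + 1), q.coeff i • f (n - i) := by
  induction q using Polynomial.induction_on' with
  | add p q hp hq => simp [seqAct_add, hp, hq, add_smul, Finset.sum_add_distrib]
  | monomial k c =>
    have : seqAct (monomial k c) f n = c • ((seqShift W : Module.End ℤ (ℕ → W)) ^ k) f n := by
      simp [seqAct, aeval_monomial]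
    rw [this, seqShift_pow]
    simp only [coeff_monomial, ite_smul, zero_smul, Finset.sum_ite_eq, Finset.mem_range]
    by_cases h : k ≤ n
    · simp [h, Nat.lt_succ_of_le h]
    · simp [h]

theorem map_seqAct {W' : Type*} [AddCommGroup W'] (g : W →+ W') (q : ℤ[X]) (f : ℕ → W) :
    (fun n => g (seqAct q f n)) = seqAct q (fun n => g (f n)) := by
  ext n
  simp [seqAct_apply, map_sum, map_zsmul]

theorem smul_seqAct {R : Type*} [Ring R] [Module R W] (r : R) (q : ℤ[X]) (f : ℕ → W) :
    seqAct q (r • f) = r • seqAct q f :=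
  (map_seqAct (DistribSMul.toAddMonoidHom W r) q f).symm

/-- Sequences of finite support, i.e. polynomials among the power series. -/
def IsPolySeq (f : ℕ → W) : Prop := ∃ M, ∀ n, M ≤ n → f n = 0

theorem IsPolySeq.add {f g : ℕ → W} (hf : IsPolySeq f) (hg : IsPolySeq g) :
    IsPolySeq (f + g) := by
  obtain ⟨M, hM⟩ := hf
  obtain ⟨M', hM'⟩ := hg
  exact ⟨max M M', fun n hn => by
    simp [hM n (le_trans (le_max_left _ _) hn), hM' n (le_trans (le_max_right _ _) hn)]⟩

theorem IsPolySeq.seqAct {f : ℕ → W} (hf : IsPolySeq f) (q : ℤ[X]) :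
    IsPolySeq (seqAct q f) := by
  obtain ⟨M, hM⟩ := hf
  refine ⟨M + q.natDegree + 1, fun n hn => ?_⟩
  rw [seqAct_apply]
  refine Finset.sum_eq_zero fun i _ => ?_
  by_cases hi : q.natDegree < i
  · simp [coeff_eq_zero_of_natDegree_lt hi]
  · rw [hM (n - i) (by omega), smul_zero]

theorem IsPolySeq.of_shift {f : ℕ → W} (hf : IsPolySeq (seqShift W f)) : IsPolySeq f := by
  obtain ⟨M, hM⟩ := hf
  exact ⟨M, fun n hn => by simpa using hM (n + 1) (by omega)⟩

/-- A polynomial with constant coefficient 1 is a unit among power series. Isolating that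
coefficient gives the recursion behind both injectivity and surjectivity of its action. -/
theorem seqAct_apply_of_coeff_zero {q : ℤ[X]} (hq : q.coeff 0 = 1) (f : ℕ → W) (n : ℕ) :
    seqAct q f n = (∑ i ∈ Finset.range n, q.coeff (i + 1) • f (n - (i + 1))) + f n := by
  rw [seqAct_apply, Finset.sum_range_succ', hq]
  simp

theorem seqAct_injective {q : ℤ[X]} (hq : q.coeff 0 = 1) {f : ℕ → W} (hf : seqAct q f = 0) :
    f = 0 := by
  ext n
  induction n using Nat.strong_induction_on with
  | _ n ih =>
    have := congrFun hf n
    rw [seqAct_apply_of_coeff_zero hq, Finset.sum_eq_zero, zero_add] at this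
    · exact this
    · intro i hi
      rw [ih _ (by have := Finset.mem_range.1 hi; omega)]
      simp

theorem exists_seqAct_eq {q : ℤ[X]} (hq : q.coeff 0 = 1) (g : ℕ → W) :
    ∃ f, seqAct q f = g := by
  let F : ∀ n : ℕ, (∀ m, m < n → W) → W := fun n f =>
    g n - ∑ i : Fin n, q.coeff (i + 1) • f (n - (i + 1)) (by have := i.2; omega)
  let f : ℕ → W := fun n => Nat.strongRec (motive := fun _ => W) F n
  have hf : ∀ n, f n = g n - ∑ i : Fin n, q.coeff (i + 1) • f (n - (i + 1)) := fun n => by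
    change Nat.strongRec (motive := fun _ => W) F n = _
    rw [Nat.strongRec_eq]
  refine ⟨f, ?_⟩
  ext n
  rw [seqAct_apply_of_coeff_zero hq, hf n,
    ← Fin.sum_univ_eq_sum_range (fun i => q.coeff (i + 1) • f (n - (i + 1)))]
  abel

/-- The leading term of a nonzero polynomial g survives multiplication by the monic q and lands at
an index at least `q.natDegree`, hence at least M. -/
theorem eq_zero_of_monic {q : ℤ[X]} (hq : q.Monic) {g : ℕ → W} (hg : IsPolySeq g) {M : ℕ}
    (hM : ∀ n, M ≤ n → seqAct q g n = 0) (hd : M ≤ q.natDegree) : g = 0 := by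
  obtain ⟨B, hB⟩ := hg
  -- Descending induction on the index: once all later entries of g vanish, the entry of the product
  -- at `n + q.natDegree` is g n.
  suffices ∀ j n, B ≤ n + j → g n = 0 by
    ext n
    exact this B n (by omega)
  intro j
  induction j with
  | zero => exact fun n hn => hB n hn
  | succ j ih =>
    intro n hn
    have h := hM (n + q.natDegree) (by omega)
    rw [seqAct_apply, Finset.sum_eq_single q.natDegree] at h
    · simpa [hq.coeff_natDegree] using h
    · intro i hi hne
      rcases lt_or_gt_of_ne hne with hlt | hgt
      · rw [ih _ (by omega), smul_zero]
      · rw [coeff_eq_zero_of_natDegree_lt hgt, zero_smul]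
    · intro hi
      exact absurd (Finset.mem_range.2 (by omega)) hi

end Seq

/-! ### A sequence of pairwise coprime monic integer polynomials -/

/-- The products of the first `n` polynomials `euclidPoly`. -/
noncomputable def euclidProd : ℕ → ℤ[X]
  | 0 => 1
  | n + 1 => euclidProd n * (1 + X * euclidProd n)

/-- Euclid's sequence `p n = 1 + X * ∏ m < n, p m`. -/
noncomputable def euclidPoly (n : ℕ) : ℤ[X] := 1 + X * euclidProd n

theorem euclidPoly_coeff_zero (n : ℕ) : (euclidPoly n).coeff 0 = 1 := by
  simp [euclidPoly]

theorem euclidPoly_monic_of {n : ℕ} (h : (euclidProd n).Monic) :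
    (euclidPoly n).Monic ∧ 1 ≤ (euclidPoly n).natDegree := by
  have hX : (X * euclidProd n).Monic := monic_X.mul h
  have hd : (X * euclidProd n).natDegree = 1 + (euclidProd n).natDegree := by
    rw [monic_X.natDegree_mul h, natDegree_X]
  have hlt : (1 : ℤ[X]).natDegree < (X * euclidProd n).natDegree := by
    rw [natDegree_one, hd]; omega
  refine ⟨?_, ?_⟩
  · rw [euclidPoly]
    exact hX.add_of_right (degree_lt_degree hlt)
  · rw [euclidPoly, natDegree_add_eq_right_of_natDegree_lt hlt, hd]
    omega

theorem euclidProd_monic (n : ℕ) : (euclidProd n).Monic := by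
  induction n with
  | zero => exact monic_one
  | succ n ih => exact ih.mul (euclidPoly_monic_of ih).1

theorem euclidPoly_monic (n : ℕ) : (euclidPoly n).Monic :=
  (euclidPoly_monic_of (euclidProd_monic n)).1

theorem one_le_natDegree_euclidPoly (n : ℕ) : 1 ≤ (euclidPoly n).natDegree :=
  (euclidPoly_monic_of (euclidProd_monic n)).2

theorem euclidPoly_dvd_euclidProd {m n : ℕ} (h : m < n) : euclidPoly m ∣ euclidProd n := by
  induction n with
  | zero => omega
  | succ n ih =>
    rcases Nat.lt_succ_iff_lt_or_eq.1 h with h | rfl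
    · exact (ih h).mul_right _
    · exact Dvd.intro_left _ rfl

/-- Each polynomial is 1 plus a multiple of every earlier one. The resulting Bézout identity has
integer coefficients, so it can be applied to sequences in an arbitrary abelian group. -/
theorem isCoprime_euclidPoly {m n : ℕ} (h : m ≠ n) :
    IsCoprime (euclidPoly m) (euclidPoly n) := by
  have key : ∀ {m n : ℕ}, m < n → IsCoprime (euclidPoly m) (euclidPoly n) := by
    intro m n h
    obtain ⟨c, hc⟩ := euclidPoly_dvd_euclidProd h
    refine ⟨-(X * c), 1, ?_⟩
    have : euclidPoly n = 1 + X * (euclidPoly m * c) := by rw [← hc, euclidPoly]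
    rw [this]
    ring
  rcases lt_or_gt_of_ne h with h | h
  · exact key h
  · exact (key h).symm

/-! ### Encoding countably many submodules into one endomorphism -/

section SeqSpace

variable {R : Type*} [Ring R] {W : Type*} [AddCommGroup W] [Module R W]

/-- The sequences with entries in `K` that become polynomials after multiplication by a power
of `p`. -/
def fracSeq (p : ℤ[X]) (K : Submodule R W) : Submodule R (ℕ → W) where
  carrier := {f | (∀ i, f i ∈ K) ∧ ∃ k, IsPolySeq (seqAct (p ^ k) f)}
  zero_mem' := ⟨fun _ => K.zero_mem, 0, 0, fun n _ => by simp⟩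
  add_mem' := by
    rintro f g ⟨hf, k, hk⟩ ⟨hg, l, hl⟩
    refine ⟨fun i => K.add_mem (hf i) (hg i), k + l, ?_⟩
    rw [seqAct_map_add]
    refine IsPolySeq.add ?_ ?_
    · rw [pow_add, mul_comm, seqAct_mul]
      exact hk.seqAct _
    · rw [pow_add, seqAct_mul]
      exact hl.seqAct _
  smul_mem' := by
    rintro r f ⟨hf, k, M, hM⟩
    refine ⟨fun i => K.smul_mem r (hf i), k, M, fun n hn => ?_⟩
    rw [smul_seqAct, Pi.smul_apply, hM n hn, smul_zero]

/-- The module of sequences that encodes the family `K`. -/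
noncomputable def seqSpace (K : ℕ → Submodule R W) : Submodule R (ℕ → W) :=
  ⨆ n, fracSeq (euclidPoly n) (K n)

theorem fracSeq_le_seqSpace (K : ℕ → Submodule R W) (n : ℕ) :
    fracSeq (euclidPoly n) (K n) ≤ seqSpace K :=
  le_iSup (fun n => fracSeq (euclidPoly n) (K n)) n

theorem IsPolySeq.seqShift {f : ℕ → W} (hf : IsPolySeq f) : IsPolySeq (seqShift W f) := by
  simpa using hf.seqAct X

theorem seqAct_seqShift (q : ℤ[X]) (f : ℕ → W) :
    seqAct q (seqShift W f) = seqShift W (seqAct q f) := by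
  rw [← seqAct_X, ← seqAct_X, ← seqAct_mul, ← seqAct_mul, mul_comm]

theorem seqShift_mem_fracSeq {p : ℤ[X]} {K : Submodule R W} {f : ℕ → W}
    (hf : f ∈ fracSeq p K) : seqShift W f ∈ fracSeq p K := by
  obtain ⟨h, k, hk⟩ := hf
  refine ⟨fun i => ?_, k, ?_⟩
  · cases i with
    | zero => exact K.zero_mem
    | succ i => exact h i
  · rw [seqAct_seqShift]
    exact hk.seqShift

variable (R W) in
/-- The shift as an `R`-linear map. -/
def seqShiftR : (ℕ → W) →ₗ[R] (ℕ → W) where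
  toFun := seqShift W
  map_add' := map_add _
  map_smul' c f := by ext n; cases n <;> simp

theorem seqSpace_map_le {W' : Type*} [AddCommGroup W'] [Module R W'] (g : (ℕ → W) →ₗ[R] (ℕ → W'))
    {K : ℕ → Submodule R W} {L : Submodule R (ℕ → W')}
    (h : ∀ n, ∀ f ∈ fracSeq (euclidPoly n) (K n), g f ∈ L) {f : ℕ → W} (hf : f ∈ seqSpace K) :
    g f ∈ L :=
  (iSup_le (fun n f hf => h n f hf) : seqSpace K ≤ L.comap g) hf

theorem seqShift_mem_seqSpace {K : ℕ → Submodule R W} {f : ℕ → W} (hf : f ∈ seqSpace K) :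
    seqShift W f ∈ seqSpace K :=
  seqSpace_map_le (seqShiftR R W)
    (fun n _ hf => fracSeq_le_seqSpace K n (seqShift_mem_fracSeq hf)) hf

theorem seqAct_mem_seqSpace {K : ℕ → Submodule R W} (q : ℤ[X]) {f : ℕ → W}
    (hf : f ∈ seqSpace K) : seqAct q f ∈ seqSpace K := by
  have hz : ∀ (c : ℤ) {f : ℕ → W}, f ∈ seqSpace K → c • f ∈ seqSpace K := fun c f hf =>
    (seqSpace K).toAddSubgroup.zsmul_mem hf c
  induction q using Polynomial.induction_on generalizing f with
  | C c =>
    have : seqAct (C c) f = c • f := by simp [seqAct]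
    rw [this]
    exact hz c hf
  | add p q hp hq =>
    rw [seqAct_add]
    exact (seqSpace K).add_mem (hp hf) (hq hf)
  | monomial n c ih =>
    rw [pow_succ, ← mul_assoc, seqAct_mul, seqAct_X]
    exact ih (seqShift_mem_seqSpace hf)

variable (R W) in
/-- Dropping the constant coefficient and dividing by the variable. -/
def seqDrop : (ℕ → W) →ₗ[R] (ℕ → W) := LinearMap.funLeft R W Nat.succ

@[simp] theorem seqDrop_apply (f : ℕ → W) (n : ℕ) : seqDrop R W f n = f (n + 1) := rfl

variable (R W) in
/-- The constant power series. -/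
def seqConst : W →ₗ[R] (ℕ → W) := LinearMap.single R (fun _ : ℕ => W) 0

@[simp] theorem seqConst_zero (w : W) : seqConst R W w 0 = w := by simp [seqConst]

@[simp] theorem seqConst_succ (w : W) (n : ℕ) : seqConst R W w (n + 1) = 0 := by simp [seqConst]

theorem isPolySeq_seqConst (w : W) : IsPolySeq (seqConst R W w) :=
  ⟨1, fun n hn => by obtain ⟨m, rfl⟩ := Nat.exists_eq_add_of_le' hn; simp⟩

variable (R) in
theorem seqConst_add_seqShift_seqDrop (f : ℕ → W) :
    seqConst R W (f 0) + seqShift W (seqDrop R W f) = f := by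
  ext n
  cases n <;> simp

/-- Here X · drop f = f − f 0, and constants are polynomials. Thus an element with zero constant
coefficient is X times an element of the same module. -/
theorem seqDrop_mem_fracSeq {p : ℤ[X]} {K : Submodule R W} {f : ℕ → W}
    (hf : f ∈ fracSeq p K) : seqDrop R W f ∈ fracSeq p K := by
  obtain ⟨h, k, hk⟩ := hf
  refine ⟨fun i => h _, k, IsPolySeq.of_shift ?_⟩
  rw [← seqAct_seqShift]
  have : seqShift W (seqDrop R W f) = f + seqConst R W (-f 0) := by
    conv_rhs => rw [← seqConst_add_seqShift_seqDrop R f]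
    simp
  rw [this, seqAct_map_add]
  exact hk.add ((isPolySeq_seqConst _).seqAct _)

theorem seqDrop_mem_seqSpace {K : ℕ → Submodule R W} {f : ℕ → W} (hf : f ∈ seqSpace K) :
    seqDrop R W f ∈ seqSpace K :=
  seqSpace_map_le (seqDrop R W)
    (fun n _ hf => fracSeq_le_seqSpace K n (seqDrop_mem_fracSeq hf)) hf

theorem seqConst_mem_fracSeq (p : ℤ[X]) {K : Submodule R W} {w : W} (hw : w ∈ K) :
    seqConst R W w ∈ fracSeq p K := by
  refine ⟨fun i => ?_, 0, by simpa using isPolySeq_seqConst w⟩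
  cases i with
  | zero => simpa using hw
  | succ i => simp

theorem exists_fracSeq_divides {p : ℤ[X]} (hp : p.coeff 0 = 1) {K : Submodule R W} {w : W}
    (hw : w ∈ K) (k : ℕ) : ∃ f ∈ fracSeq p K, seqAct (p ^ k) f = seqConst R W w := by
  have hk : (p ^ k).coeff 0 = 1 := by
    rw [coeff_zero_eq_eval_zero, eval_pow, ← coeff_zero_eq_eval_zero, hp, one_pow]
  -- The division takes place in K[[X]] rather than W[[X]], which keeps the entries of the quotient
  -- in K.
  obtain ⟨f, hf⟩ := exists_seqAct_eq hk (seqConst R K ⟨w, hw⟩)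
  have h : seqAct (p ^ k) (fun n => (f n : W)) = seqConst R W w := by
    have := map_seqAct K.subtype.toAddMonoidHom (p ^ k) f
    rw [hf] at this
    refine Eq.trans this.symm ?_
    ext n
    cases n <;> simp
  exact ⟨fun n => f n, ⟨fun n => (f n).2, k, h ▸ isPolySeq_seqConst w⟩, h⟩

/-- Sequences that become polynomials after multiplication by a polynomial that is coprime to `p`
and has constant coefficient `1`. -/
def coprimeFrac (W : Type*) [AddCommGroup W] (p : ℤ[X]) : AddSubgroup (ℕ → W) where
  carrier := {f | ∃ d : ℤ[X], IsCoprime d p ∧ d.coeff 0 = 1 ∧ IsPolySeq (seqAct d f)}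
  zero_mem' := ⟨1, isCoprime_one_left, by simp, 0, fun n _ => by simp⟩
  add_mem' := by
    rintro f g ⟨d, hd, hd0, hf⟩ ⟨e, he, he0, hg⟩
    refine ⟨d * e, hd.mul_left he, by simp [mul_coeff_zero, hd0, he0], ?_⟩
    rw [seqAct_map_add]
    refine IsPolySeq.add ?_ ?_
    · rw [mul_comm, seqAct_mul]
      exact hf.seqAct _
    · rw [seqAct_mul]
      exact hg.seqAct _
  neg_mem' := by
    rintro f ⟨d, hd, hd0, hf⟩
    refine ⟨d, hd, hd0, ?_⟩
    have : seqAct d (-f) = seqAct (-1) (seqAct d f) := by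
      rw [← seqAct_mul, mul_comm, seqAct_mul]
      congr 1
      simp [seqAct]
    rw [this]
    exact hf.seqAct _

/-- Write f with denominator d and let M bound the degree of the numerator d f. If f = p^M g and g
has denominator e coprime to p, Bézout shows that d f is p^M times a polynomial. Since p^M has
degree at least M, that polynomial is zero. -/
theorem eq_zero_of_divisible {p : ℤ[X]} (hm : p.Monic) (hd : 1 ≤ p.natDegree)
    {f : ℕ → W} (hf : f ∈ coprimeFrac W p)
    (hdiv : ∀ k, ∃ g ∈ coprimeFrac W p, seqAct (p ^ k) g = f) : f = 0 := by
  obtain ⟨d, hdp, hd0, M, hM⟩ := hf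
  obtain ⟨g, ⟨e, hep, he0, hg⟩, hgf⟩ := hdiv M
  refine seqAct_injective hd0 ?_
  obtain ⟨u, t, hut⟩ := (hep.pow_right (n := M)).symm
  have key : seqAct d f = seqAct (p ^ M) (seqAct u (seqAct d f) + seqAct (t * d) (seqAct e g)) := by
    rw [seqAct_map_add, ← seqAct_mul, ← seqAct_mul, ← seqAct_mul, ← hgf, ← seqAct_mul,
      ← seqAct_mul, ← seqAct_mul, ← seqAct_add]
    congr 1
    calc d * p ^ M = d * p ^ M * (u * p ^ M + t * e) := by rw [hut, mul_one]
      _ = _ := by ring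
  have hz : seqAct u (seqAct d f) + seqAct (t * d) (seqAct e g) = 0 := by
    refine eq_zero_of_monic (hm.pow M) (M := M) ?_ ?_ ?_
    · exact (IsPolySeq.seqAct ⟨M, hM⟩ _).add (hg.seqAct _)
    · intro n hn
      rw [← key]
      exact hM n hn
    · rw [hm.natDegree_pow]
      exact Nat.le_mul_of_pos_right _ hd
  rw [key, hz, seqAct_zero]

/-- Modulo K n the n-th summand disappears, and the other summands have powers of p m with m ≠ n as
denominators. -/
theorem mkQ_mem_coprimeFrac {K : ℕ → Submodule R W} (n : ℕ) {f : ℕ → W} (hf : f ∈ seqSpace K) :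
    (fun i => (K n).mkQ (f i)) ∈ coprimeFrac (W ⧸ K n) (euclidPoly n) := by
  refine Submodule.iSup_induction _ (motive := fun f =>
    (fun i => (K n).mkQ (f i)) ∈ coprimeFrac (W ⧸ K n) (euclidPoly n)) hf ?_ ?_ ?_
  · rintro m f ⟨hf, k, M, hM⟩
    by_cases hmn : m = n
    · subst hmn
      have : (fun i => (K m).mkQ (f i)) = 0 := by
        ext i
        simpa using hf i
      rw [this]
      exact zero_mem _
    · refine ⟨euclidPoly m ^ k, (isCoprime_euclidPoly hmn).pow_left, ?_, M, fun i hi => ?_⟩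
      · rw [coeff_zero_eq_eval_zero, eval_pow, ← coeff_zero_eq_eval_zero,
          euclidPoly_coeff_zero, one_pow]
      · have := congrFun (map_seqAct (K n).mkQ.toAddMonoidHom (euclidPoly m ^ k) f) i
        refine Eq.trans this.symm ?_
        rw [hM i hi, map_zero]
  · have : (fun i => (K n).mkQ ((0 : ℕ → W) i)) = 0 := by ext i; simp
    rw [this]
    exact zero_mem _
  · intro f g hf hg
    have : (fun i => (K n).mkQ ((f + g) i)) =
        (fun i => (K n).mkQ (f i)) + (fun i => (K n).mkQ (g i)) := by ext i; simp
    rw [this]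
    exact add_mem hf hg

theorem mem_of_divisible {K : ℕ → Submodule R W} (n : ℕ) {f : ℕ → W} (hf : f ∈ seqSpace K)
    (hdiv : ∀ k, ∃ g ∈ seqSpace K, seqAct (euclidPoly n ^ k) g = f) (i : ℕ) : f i ∈ K n := by
  have : (fun i => (K n).mkQ (f i)) = 0 := by
    refine eq_zero_of_divisible (euclidPoly_monic n) (one_le_natDegree_euclidPoly n)
      (mkQ_mem_coprimeFrac n hf) fun k => ?_
    obtain ⟨g, hg, hgf⟩ := hdiv k
    exact ⟨_, mkQ_mem_coprimeFrac n hg, by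
      rw [← hgf]; exact (map_seqAct (K n).mkQ.toAddMonoidHom _ g).symm⟩
  simpa using congrFun this i

/-- The linear isomorphism induced on sequences by one on coefficients. -/
def seqMap {W' : Type*} [AddCommGroup W'] [Module R W'] (g : W →ₗ[R] W') :
    (ℕ → W) →ₗ[R] (ℕ → W') := g.compLeft ℕ

theorem seqMap_mem_seqSpace {W' : Type*} [AddCommGroup W'] [Module R W'] (g : W →ₗ[R] W')
    {K : ℕ → Submodule R W} {K' : ℕ → Submodule R W'} (h : ∀ n, ∀ w ∈ K n, g w ∈ K' n)
    {f : ℕ → W} (hf : f ∈ seqSpace K) : seqMap g f ∈ seqSpace K' := by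
  refine seqSpace_map_le (seqMap g) (fun n f hf => fracSeq_le_seqSpace K' n ?_) hf
  obtain ⟨hf, k, M, hM⟩ := hf
  refine ⟨fun i => h n _ (hf i), k, M, fun i hi => ?_⟩
  have := congrFun (map_seqAct g.toAddMonoidHom (euclidPoly n ^ k) f) i
  refine Eq.trans this.symm ?_
  rw [hM i hi, map_zero]

theorem seqShift_seqMap {W' : Type*} [AddCommGroup W'] [Module R W'] (g : W →ₗ[R] W')
    (f : ℕ → W) : seqMap g (seqShift W f) = seqShift W' (seqMap g f) := by
  ext n
  cases n <;> simp [seqMap]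

variable {W' : Type*} [AddCommGroup W'] [Module R W']

theorem coe_map_seqAct {K : ℕ → Submodule R W} {K' : ℕ → Submodule R W'}
    (φ : seqSpace K →ₗ[R] seqSpace K')
    (hφ : ∀ v w : seqSpace K, (w : ℕ → W) = seqShift W v → (φ w : ℕ → W') = seqShift W' (φ v))
    (q : ℤ[X]) (v w : seqSpace K) (h : (w : ℕ → W) = seqAct q v) :
    (φ w : ℕ → W') = seqAct q (φ v) := by
  induction q using Polynomial.induction_on generalizing v w with
  | C c =>
    have e : ∀ f : ℕ → W, seqAct (C c) f = c • f := by
      simp [seqAct]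
    have e' : ∀ f : ℕ → W', seqAct (C c) f = c • f := by
      simp [seqAct]
    have hw : w = c • v := by
      ext1
      rw [h, e]
      rfl
    rw [hw, map_zsmul, e']
    rfl
  | add p q hp hq =>
    have hw : w = (⟨seqAct p v, seqAct_mem_seqSpace p v.2⟩ : seqSpace K) +
        ⟨seqAct q v, seqAct_mem_seqSpace q v.2⟩ := by
      ext1
      rw [h, seqAct_add]
      rfl
    rw [hw, map_add, Submodule.coe_add, seqAct_add, hp v ⟨_, seqAct_mem_seqSpace p v.2⟩ rfl,
      hq v ⟨_, seqAct_mem_seqSpace q v.2⟩ rfl]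
  | monomial n c ih =>
    rw [pow_succ, ← mul_assoc, seqAct_mul, seqAct_X] at h ⊢
    rw [ih ⟨seqShift W v, seqShift_mem_seqSpace v.2⟩ w h, hφ v _ rfl]

/-- The map on coefficients induced by a map of the encoding modules. -/
noncomputable def coeffMap {K : ℕ → Submodule R W} {K' : ℕ → Submodule R W'}
    (hK : ∀ w : W, seqConst R W w ∈ seqSpace K) (φ : seqSpace K →ₗ[R] seqSpace K') : W →ₗ[R] W' :=
  LinearMap.proj 0 ∘ₗ (seqSpace K').subtype ∘ₗ φ ∘ₗ (seqConst R W).codRestrict _ hK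

/-- Split v as its constant coefficient plus X times a member of the encoding; φ sends the second
part to a multiple of X, which has constant coefficient zero. -/
theorem coeffMap_apply_zero {K : ℕ → Submodule R W} {K' : ℕ → Submodule R W'}
    (hK : ∀ w : W, seqConst R W w ∈ seqSpace K) (φ : seqSpace K →ₗ[R] seqSpace K')
    (hφ : ∀ v w : seqSpace K, (w : ℕ → W) = seqShift W v → (φ w : ℕ → W') = seqShift W' (φ v))
    (v : seqSpace K) : coeffMap hK φ ((v : ℕ → W) 0) = (φ v : ℕ → W') 0 := by
  have hv : v = ⟨seqConst R W ((v : ℕ → W) 0), hK _⟩ +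
      ⟨seqShift W (seqDrop R W v), seqShift_mem_seqSpace (seqDrop_mem_seqSpace v.2)⟩ := by
    ext1
    exact (seqConst_add_seqShift_seqDrop R _).symm
  have h2 : (φ v : ℕ → W') = φ ⟨seqConst R W ((v : ℕ → W) 0), hK _⟩ +
      seqShift W' (φ ⟨seqDrop R W v, seqDrop_mem_seqSpace v.2⟩) := by
    conv_lhs => rw [hv]
    rw [map_add, Submodule.coe_add, hφ ⟨seqDrop R W v, seqDrop_mem_seqSpace v.2⟩
      ⟨_, seqShift_mem_seqSpace
      (seqDrop_mem_seqSpace v.2)⟩ rfl]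
  rw [h2]
  simp [coeffMap, LinearMap.codRestrict]

/-- Divisibility by all powers of p n is expressed through the shift alone, so φ transports it. -/
theorem coeffMap_mem {K : ℕ → Submodule R W} {K' : ℕ → Submodule R W'}
    (hK : ∀ w : W, seqConst R W w ∈ seqSpace K) (φ : seqSpace K →ₗ[R] seqSpace K')
    (hφ : ∀ v w : seqSpace K, (w : ℕ → W) = seqShift W v → (φ w : ℕ → W') = seqShift W' (φ v))
    {n : ℕ} {w : W} (hw : w ∈ K n) : coeffMap hK φ w ∈ K' n := by
  refine mem_of_divisible n (φ ⟨seqConst R W w, hK w⟩).2 (fun k => ?_) 0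
  obtain ⟨f, hf, hfw⟩ := exists_fracSeq_divides (euclidPoly_coeff_zero n) hw k
  exact ⟨φ ⟨f, fracSeq_le_seqSpace K n hf⟩, (φ _).2,
    (coe_map_seqAct φ hφ _ _ _ hfw.symm).symm⟩

/-- An isomorphism of the encoding modules with endomorphism yields an isomorphism of the encoded
families of submodules. -/
theorem exists_equiv_of_seqSpace_equiv {K : ℕ → Submodule R W} {K' : ℕ → Submodule R W'}
    {m : ℕ} (hm : K m = ⊤) (hm' : K' m = ⊤) (φ : seqSpace K ≃ₗ[R] seqSpace K')
    (hφ : ∀ v w : seqSpace K, (w : ℕ → W) = seqShift W v → (φ w : ℕ → W') = seqShift W' (φ v)) :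
    ∃ h : W ≃ₗ[R] W', ∀ n w, w ∈ K n ↔ h w ∈ K' n := by
  have hK : ∀ w : W, seqConst R W w ∈ seqSpace K := fun w =>
    fracSeq_le_seqSpace K m (seqConst_mem_fracSeq _ (hm ▸ Submodule.mem_top))
  have hK' : ∀ w : W', seqConst R W' w ∈ seqSpace K' := fun w =>
    fracSeq_le_seqSpace K' m (seqConst_mem_fracSeq _ (hm' ▸ Submodule.mem_top))
  have hφ' : ∀ v w : seqSpace K', (w : ℕ → W') = seqShift W' v →
      (φ.symm w : ℕ → W) = seqShift W (φ.symm v) := by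
    intro v w h
    have := hφ (φ.symm v) ⟨seqShift W (φ.symm v), seqShift_mem_seqSpace (φ.symm v).2⟩ rfl
    rw [φ.apply_symm_apply, ← h] at this
    rw [← Subtype.ext this, φ.symm_apply_apply]
  have h1 : ∀ w, coeffMap hK' φ.symm.toLinearMap (coeffMap hK φ.toLinearMap w) = w := by
    intro w
    have := coeffMap_apply_zero hK' φ.symm.toLinearMap hφ' (φ ⟨seqConst R W w, hK w⟩)
    have e : coeffMap hK φ.toLinearMap w = (φ ⟨seqConst R W w, hK w⟩ : ℕ → W') 0 := rfl
    rw [e, this]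
    simp
  have h2 : ∀ w, coeffMap hK φ.toLinearMap (coeffMap hK' φ.symm.toLinearMap w) = w := by
    intro w
    have := coeffMap_apply_zero hK φ.toLinearMap hφ (φ.symm ⟨seqConst R W' w, hK' w⟩)
    have e : coeffMap hK' φ.symm.toLinearMap w = (φ.symm ⟨seqConst R W' w, hK' w⟩ : ℕ → W) 0 := rfl
    rw [e, this]
    simp
  refine ⟨LinearEquiv.ofLinearMap (coeffMap hK φ.toLinearMap) (coeffMap hK' φ.symm.toLinearMap)
    (LinearMap.ext h2) (LinearMap.ext h1), fun n w => ⟨fun hw => ?_, fun hw => ?_⟩⟩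
  · exact coeffMap_mem hK _ hφ hw
  · have := coeffMap_mem hK' _ hφ' hw
    rwa [LinearEquiv.coe_ofLinearMap, h1] at this

theorem countable_coprimeFrac [Countable W] (p : ℤ[X]) :
    (coprimeFrac W p : Set (ℕ → W)).Countable := by
  have hpoly : {f : ℕ → W | IsPolySeq f}.Countable := by
    have : {f : ℕ → W | IsPolySeq f} ⊆
        ⋃ M : ℕ, Set.range fun (g : Fin M → W) (n : ℕ) => if h : n < M then g ⟨n, h⟩ else 0 := by
      rintro f ⟨M, hM⟩
      refine Set.mem_iUnion.2 ⟨M, fun i => f i, ?_⟩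
      ext n
      by_cases h : n < M
      · simp [h]
      · simp [h, hM n (by omega)]
    exact (Set.countable_iUnion fun M => Set.countable_range _).mono this
  have : Countable ℤ[X] :=
    Cardinal.mk_le_aleph0_iff.1 (Polynomial.cardinalMk_le_max.trans (by simp))
  have : (coprimeFrac W p : Set (ℕ → W)) ⊆
      ⋃ d : {d : ℤ[X] // d.coeff 0 = 1}, (seqAct d.1) ⁻¹' {f : ℕ → W | IsPolySeq f} := by
    rintro f ⟨d, _, hd, hf⟩
    exact Set.mem_iUnion.2 ⟨⟨d, hd⟩, hf⟩
  refine (Set.countable_iUnion fun d => hpoly.preimage_of_injOn ?_).mono this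
  intro f _ g _ h
  refine sub_eq_zero.1 (seqAct_injective d.2 ?_)
  rw [seqAct_map_sub]
  exact sub_eq_zero.2 h

/-- Coprimality to 1 is no restriction; this places all encodings, whatever the family K, in one set
that is countable when W is. -/
theorem seqSpace_le_coprimeFrac (K : ℕ → Submodule R W) {f : ℕ → W} (hf : f ∈ seqSpace K) :
    f ∈ coprimeFrac W 1 := by
  refine Submodule.iSup_induction _ (motive := fun f => f ∈ coprimeFrac W 1) hf ?_ (zero_mem _)
    fun _ _ => add_mem
  rintro n f ⟨-, k, hk⟩
  refine ⟨euclidPoly n ^ k, isCoprime_one_right, ?_, hk⟩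
  rw [coeff_zero_eq_eval_zero, eval_pow, ← coeff_zero_eq_eval_zero, euclidPoly_coeff_zero, one_pow]

end SeqSpace

/-! ### Permutations in free position -/

/-- A family of permutations of a ranked set, closed under inverses.  Each of them has a threshold
below which it fixes all points that it does not move beyond the threshold, and above which it fixes
no point.  Every point is moved to one of smaller rank by at most one of the permutations. -/
structure FreeSystem (X ι : Type*) where
  rank : X → ℕ
  rank_injective : Function.Injective rank
  act : ι → Equiv.Perm X
  inv : ι → ι
  inv_ne (i : ι) : inv i ≠ i
  inv_inv (i : ι) : inv (inv i) = i
  act_inv (i : ι) : act (inv i) = (act i)⁻¹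
  thr : ι → ℕ
  act_of_lt {i : ι} {x : X} : rank x < thr i → act i x = x ∨ thr i ≤ rank (act i x)
  act_ne {i : ι} {x : X} : thr i ≤ rank x → act i x ≠ x
  descent {i j : ι} {x : X} : rank (act i x) < rank x → rank (act j x) < rank x → i = j

namespace FreeSystem

variable {X ι : Type*} (F : FreeSystem X ι) (R : Type*) [Ring R] (A : Type*) [AddCommGroup A]
  [Module R A]

/-- The linear action of a permutation of the family. -/
noncomputable def move (i : ι) : (X →₀ A) ≃ₗ[R] (X →₀ A) := Finsupp.domLCongr (F.act i)

/-- The vectors supported on points of rank below `N`. -/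
def stage (N : ℕ) : Submodule R (X →₀ A) where
  carrier := {p | ∀ x, N ≤ F.rank x → p x = 0}
  zero_mem' := fun _ _ => rfl
  add_mem' := fun hp hq x hx => by simp [hp x hx, hq x hx]
  smul_mem' := fun r p hp x hx => by simp [hp x hx]

variable {A}

/-- A submodule of the `N`-th stage is closed if the family does not lead out of it within the
stage. -/
def Closed (N : ℕ) (S : Submodule R (X →₀ A)) : Prop :=
  S ≤ F.stage R A N ∧ ∀ i, ∀ p ∈ S, F.move R A i p ∈ F.stage R A N → F.move R A i p ∈ S

/-- `S` contains no nonzero vector supported on a single point. -/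
def NoSingle {R : Type*} [Ring R] [Module R A] (S : Submodule R (X →₀ A)) : Prop :=
  ∀ x a, Finsupp.single x a ∈ S → a = 0

variable {R F}

theorem move_apply (i : ι) (p : X →₀ A) (x : X) :
    F.move R A i p x = p (F.act (F.inv i) x) := by
  rw [F.act_inv]
  simp [move, Finsupp.domLCongr, Finsupp.domCongr, Finsupp.equivMapDomain_apply]

theorem act_inv_act (i : ι) (x : X) : F.act (F.inv i) (F.act i x) = x := by
  rw [F.act_inv]
  exact (F.act i).symm_apply_apply x

theorem act_act_inv (i : ι) (x : X) : F.act i (F.act (F.inv i) x) = x := by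
  rw [F.act_inv]
  exact (F.act i).apply_symm_apply x

theorem move_apply_act (i : ι) (p : X →₀ A) (x : X) : F.move R A i p (F.act i x) = p x := by
  rw [move_apply, act_inv_act]

theorem move_single (i : ι) (x : X) (a : A) :
    F.move R A i (Finsupp.single x a) = Finsupp.single (F.act i x) a := by
  simp [move]

theorem move_inv_move (i : ι) (p : X →₀ A) : F.move R A (F.inv i) (F.move R A i p) = p := by
  ext x
  rw [move_apply, move_apply, F.inv_inv, act_inv_act]

theorem move_move_inv (i : ι) (p : X →₀ A) : F.move R A i (F.move R A (F.inv i) p) = p := by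
  ext x
  rw [move_apply, move_apply, F.inv_inv, act_act_inv]

theorem stage_mono {M N : ℕ} (h : M ≤ N) : F.stage R A M ≤ F.stage R A N :=
  fun _ hp x hx => hp x (h.trans hx)

theorem rank_lt_of_ne_zero {N : ℕ} {p : X →₀ A} (hp : p ∈ F.stage R A N) {x : X} (h : p x ≠ 0) :
    F.rank x < N := by
  by_contra hlt
  exact h (hp x (by omega))

/-- Points of the support and their images have rank at most N, below the threshold, so `act_of_lt`
leaves only the possibility that they are fixed. -/
theorem move_eq_self {N : ℕ} {i : ι} (h : N < F.thr i) {p : X →₀ A}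
    (hp : p ∈ F.stage R A (N + 1)) (hi : F.move R A i p ∈ F.stage R A (N + 1)) :
    F.move R A i p = p := by
  have key : ∀ x, p x ≠ 0 → F.act i x = x := fun x hx => by
    have h1 := rank_lt_of_ne_zero hp hx
    rw [← move_apply_act (R := R) (F := F) i] at hx
    have h2 := rank_lt_of_ne_zero hi hx
    exact (F.act_of_lt (i := i) (x := x) (by omega)).resolve_right (by omega)
  ext x
  rw [move_apply]
  by_cases hx : p (F.act (F.inv i) x) = 0
  · rw [hx]
    by_contra hne
    have := key x (Ne.symm hne)
    rw [← this, act_inv_act] at hx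
    exact hne hx.symm
  · have := key _ hx
    rw [act_act_inv] at this
    rw [← this]

theorem mem_stage_of_apply_eq_zero {N : ℕ} {y : X} (hy : F.rank y = N) {p : X →₀ A}
    (hp : p ∈ F.stage R A (N + 1)) (h : p y = 0) : p ∈ F.stage R A N := by
  intro x hx
  rcases Nat.eq_or_lt_of_le hx with hx | hx
  · rw [← F.rank_injective (hy.trans hx)]
    exact h
  · exact hp x hx

theorem exists_of_notMem_stage {N : ℕ} {p : X →₀ A}
    (hp : p ∈ F.stage R A (N + 1)) (h : p ∉ F.stage R A N) : ∃ y, F.rank y = N ∧ p y ≠ 0 := by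
  by_contra! hne
  refine h fun x hx => ?_
  rcases Nat.eq_or_lt_of_le hx with hx | hx
  · exact hne x hx.symm
  · exact hp x hx

/-- Passing to the next stage adds at most one point y. By `descent` at most one permutation j
lowers y, so the only new vectors forced on S are the translates of S by the inverse of j that fit
into the new stage. -/
theorem Closed.exists_extension {N : ℕ} {S : Submodule R (X →₀ A)} (hS : F.Closed R N S)
    (hs : NoSingle S) :
    ∃ S', S ≤ S' ∧ F.Closed R (N + 1) S' ∧ NoSingle S' := by
  by_cases hex : ∃ y j, F.rank y = N ∧ F.rank (F.act j y) < N
  · obtain ⟨y, j, hy, hj⟩ := hex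
    have step : ∀ i, ∀ p ∈ S, F.move R A i p ∈ F.stage R A (N + 1) → F.move R A i p ∈
        S ⊔ (S.map (F.move R A (F.inv j)).toLinearMap ⊓ F.stage R A (N + 1)) := by
      intro i p hp hi
      by_cases hN : F.move R A i p ∈ F.stage R A N
      · exact Submodule.mem_sup_left (hS.2 i p hp hN)
      · obtain ⟨y', hy', hne⟩ := exists_of_notMem_stage hi hN
        obtain rfl := F.rank_injective (hy.trans hy'.symm)
        rw [move_apply] at hne
        have hij := F.descent (hy ▸ rank_lt_of_ne_zero (hS.1 hp) hne) (hy ▸ hj)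
        have : i = F.inv j := by rw [← hij, F.inv_inv]
        subst this
        exact Submodule.mem_sup_right ⟨⟨p, hp, rfl⟩, hi⟩
    refine ⟨S ⊔ (S.map (F.move R A (F.inv j)).toLinearMap ⊓ F.stage R A (N + 1)), le_sup_left,
      ⟨sup_le (hS.1.trans (stage_mono (by omega))) inf_le_right, ?_⟩, ?_⟩
    · intro i p hp hi
      have hpst : p ∈ F.stage R A (N + 1) :=
        (sup_le (hS.1.trans (stage_mono (by omega))) inf_le_right : _ ≤ F.stage R A (N + 1)) hp
      obtain ⟨s, hs', t, ⟨⟨v, hv, hvt⟩, ht⟩, rfl⟩ := Submodule.mem_sup.1 hp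
      replace hvt : F.move R A (F.inv j) v = t := hvt
      -- If the coordinate at y vanishes, t is in the old stage and hence in S. Otherwise i either
      -- fixes the vector or moves y downwards, which forces i = j and carries t back to v.
      by_cases hpy : (s + t) y = 0
      · have hst : s + t ∈ F.stage R A N := mem_stage_of_apply_eq_zero hy hpst hpy
        have ht' : t ∈ F.stage R A N := by
          simpa using Submodule.sub_mem _ hst (hS.1 hs')
        have htS : t ∈ S := hvt ▸ hS.2 _ v hv (hvt ▸ ht')
        exact step i _ (S.add_mem hs' htS) hi
      · rw [← move_apply_act (R := R) (F := F) i] at hpy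
        have hlt := rank_lt_of_ne_zero hi hpy
        by_cases hthr : N < F.thr i
        · rwa [move_eq_self hthr hpst hi]
        · have hne : F.rank (F.act i y) ≠ N := fun h =>
            F.act_ne (i := i) (x := y) (by omega) (F.rank_injective (h.trans hy.symm))
          have hij : i = j := F.descent (x := y) (by omega) (by omega)
          subst hij
          have htv : F.move R A i t = v := by
            rw [← hvt, move_move_inv]
          rw [map_add, htv] at hi ⊢
          have hvst := stage_mono (Nat.le_succ N) (hS.1 hv)
          refine Submodule.add_mem _ (step i s hs' ?_) (Submodule.mem_sup_left hv)
          simpa using Submodule.sub_mem _ hi hvst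
    · intro x a hxa
      by_contra ha
      have hpst : Finsupp.single x a ∈ F.stage R A (N + 1) :=
        (sup_le (hS.1.trans (stage_mono (by omega))) inf_le_right : _ ≤ F.stage R A (N + 1)) hxa
      obtain ⟨s, hs', t, ⟨⟨v, hv, hvt⟩, ht⟩, hst⟩ := Submodule.mem_sup.1 hxa
      replace hvt : F.move R A (F.inv j) v = t := hvt
      by_cases hx : Finsupp.single x a ∈ F.stage R A N
      · have ht' : t ∈ F.stage R A N := by
          have := Submodule.sub_mem _ hx (hS.1 hs')
          rwa [← hst, add_sub_cancel_left] at this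
        have htS : t ∈ S := hvt ▸ hS.2 _ v hv (hvt ▸ ht')
        exact ha (hs x a (hst ▸ S.add_mem hs' htS))
      · obtain ⟨y', hy', hne⟩ := exists_of_notMem_stage hpst hx
        obtain rfl := F.rank_injective (hy.trans hy'.symm)
        have hxy : x = y := by
          by_contra h
          exact hne (Finsupp.single_eq_of_ne (Ne.symm h))
        subst hxy
        have htv : F.move R A j t = v := by
          rw [← hvt, move_move_inv]
        -- Applying j takes the vector at y to one supported at a single older point, which turns
        -- out to lie in S.
        have h1 : F.move R A j s + v = Finsupp.single (F.act j x) a := by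
          rw [← htv, ← map_add, hst, move_single]
        have h2 : Finsupp.single (F.act j x) a ∈ F.stage R A N := by
          intro z hz
          exact Finsupp.single_eq_of_ne (by rintro rfl; omega)
        have h3 : F.move R A j s ∈ F.stage R A N := by
          have := Submodule.sub_mem _ h2 (hS.1 hv)
          rwa [← h1, add_sub_cancel_right] at this
        exact ha (hs _ a (h1 ▸ S.add_mem (hS.2 j s hs' h3) hv))
  -- When nothing lowers y, no translate of a vector in S can reach y within the new stage, so S is
  -- already closed.
  · push Not at hex
    refine ⟨S, le_rfl, ⟨hS.1.trans (stage_mono (by omega)), fun i p hp hi => hS.2 i p hp ?_⟩, hs⟩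
    by_contra h
    obtain ⟨y, hy, hne⟩ := exists_of_notMem_stage hi h
    rw [move_apply] at hne
    have := rank_lt_of_ne_zero (hS.1 hp) hne
    have := hex y (F.inv i) hy
    omega

/-- Some vector in the range of `v` is supported at more than one point. -/
def Spread (v : A →ₗ[R] (X →₀ A)) : Prop :=
  ∃ x x', x ≠ x' ∧ (∃ a, v a x ≠ 0) ∧ ∃ a, v a x' ≠ 0

/-- By simplicity each coordinate of v is injective or zero, so v a has the same support for all a ≠
0. -/
theorem apply_eq_zero_of_simple [IsSimpleModule R A] (v : A →ₗ[R] (X →₀ A)) {x : X} {a : A}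
    (ha : a ≠ 0) (h : v a x = 0) (b : A) : v b x = 0 := by
  rcases LinearMap.injective_or_eq_zero (Finsupp.lapply x ∘ₗ v) with hi | hi
  · exact absurd (hi (a₂ := 0) (by simpa using h)) ha
  · exact LinearMap.congr_fun hi b

/-- The map v is translated to lower stages as long as possible. At a minimal stage its range is
itself closed, and the closed submodule is then extended back through the stages. -/
theorem exists_closed [IsSimpleModule R A] (N : ℕ) (v : A →ₗ[R] (X →₀ A))
    (hv : ∀ a, v a ∈ F.stage R A N) (h2 : Spread v) :
    ∃ S, F.Closed R N S ∧ NoSingle S ∧ ∀ a, v a ∈ S := by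
  induction N generalizing v with
  | zero =>
    obtain ⟨x, -, -, ⟨a, ha⟩, -⟩ := h2
    exact absurd (hv a x (Nat.zero_le _)) ha
  | succ N ih =>
    by_cases h0 : ∀ a, v a ∈ F.stage R A N
    · obtain ⟨S, hS, hs, hvS⟩ := ih v h0 h2
      obtain ⟨S', hle, hS', hs'⟩ := hS.exists_extension hs
      exact ⟨S', hS', hs', fun a => hle (hvS a)⟩
    by_cases h1 : ∃ i, ∀ a, F.move R A i (v a) ∈ F.stage R A N
    · obtain ⟨i, hi⟩ := h1
      have h2' : Spread ((F.move R A i).toLinearMap ∘ₗ v) := by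
        obtain ⟨x, x', hne, ⟨a, ha⟩, b, hb⟩ := h2
        refine ⟨F.act i x, F.act i x', (F.act i).injective.ne hne, ⟨a, ?_⟩, b, ?_⟩
        · change F.move R A i (v a) (F.act i x) ≠ 0
          rwa [move_apply_act]
        · change F.move R A i (v b) (F.act i x') ≠ 0
          rwa [move_apply_act]
      obtain ⟨S, hS, hs, hvS⟩ := ih _ hi h2'
      obtain ⟨S', hle, hS', hs'⟩ := hS.exists_extension hs
      refine ⟨S', hS', hs', fun a => ?_⟩
      have := hS'.2 (F.inv i) _ (hle (hvS a))
      simp only [LinearMap.comp_apply, LinearEquiv.coe_coe, move_inv_move] at this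
      exact this (hv a)
    -- Minimal case: a permutation i that is not trivial on the range would keep the top point y in
    -- the support of both v and its translate. Then i and its inverse would both lower y, against
    -- `descent` and `inv_ne`.
    · refine ⟨LinearMap.range v, ⟨?_, ?_⟩, ?_, fun a => ⟨a, rfl⟩⟩
      · rintro _ ⟨a, rfl⟩
        exact hv a
      · rintro i _ ⟨a, rfl⟩ hi
        by_cases ha : a = 0
        · simp [ha]
        by_cases hthr : N < F.thr i
        · rw [move_eq_self hthr (hv a) hi]
          exact ⟨a, rfl⟩
        exfalso
        push Not at h0 h1
        obtain ⟨b, hb⟩ := h0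
        obtain ⟨y, hy, hne⟩ := exists_of_notMem_stage (hv b) hb
        have hya : v a y ≠ 0 := fun h => hne (apply_eq_zero_of_simple v ha h b)
        rw [← move_apply_act (R := R) (F := F) i] at hya
        have hlt := rank_lt_of_ne_zero hi hya
        have hney : F.rank (F.act i y) ≠ N := fun h =>
          F.act_ne (i := i) (x := y) (by omega) (F.rank_injective (h.trans hy.symm))
        obtain ⟨c, hc⟩ := h1 i
        have hca : F.move R A i (v a) ∉ F.stage R A N := by
          intro hmem
          refine hc fun x hx => ?_
          rw [move_apply]
          refine apply_eq_zero_of_simple v ha ?_ c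
          rw [← move_apply (R := R)]
          exact hmem x hx
        obtain ⟨y', hy', hne'⟩ := exists_of_notMem_stage hi hca
        obtain rfl := F.rank_injective (hy.trans hy'.symm)
        rw [move_apply] at hne'
        have hlt' := rank_lt_of_ne_zero (hv a) hne'
        have hney' : F.rank (F.act (F.inv i) y) ≠ N := fun h => by
          have h3 := F.rank_injective (h.trans hy.symm)
          have h4 := act_act_inv (F := F) i y
          rw [h3] at h4
          exact F.act_ne (i := i) (x := y) (by omega) h4
        exact F.inv_ne i (F.descent (x := y) (by omega) (by omega))
      · rintro x a ⟨b, hb⟩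
        by_contra ha
        have hb0 : b ≠ 0 := by
          rintro rfl
          rw [map_zero] at hb
          exact ha (Finsupp.single_eq_zero.1 hb.symm)
        obtain ⟨z, z', hne, ⟨c, hc⟩, c', hc'⟩ := h2
        have hz : z = x := by
          by_contra h
          exact hc (apply_eq_zero_of_simple v hb0 (by rw [hb, Finsupp.single_eq_of_ne h]) c)
        have hz' : z' = x := by
          by_contra h
          exact hc' (apply_eq_zero_of_simple v hb0 (by rw [hb, Finsupp.single_eq_of_ne h]) c')
        exact hne (hz.trans hz'.symm)

variable (F R) in
/-- Invariance of a submodule under all permutations of the family. -/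
def Invariant (S : Submodule R (X →₀ A)) : Prop := ∀ i, ∀ p ∈ S, F.move R A i p ∈ S

theorem exists_mem_stage (p : X →₀ A) : ∃ N, p ∈ F.stage R A N := by
  refine ⟨p.support.sup F.rank + 1, fun x hx => ?_⟩
  by_contra h
  have := Finset.le_sup (f := F.rank) (Finsupp.mem_support_iff.2 h)
  omega

theorem exists_mem_stage_linearMap [IsSimpleModule R A] (v : A →ₗ[R] (X →₀ A)) :
    ∃ N, ∀ a, v a ∈ F.stage R A N := by
  have := IsSimpleModule.nontrivial R A
  obtain ⟨a, ha⟩ := exists_ne (0 : A)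
  obtain ⟨N, hN⟩ := exists_mem_stage (R := R) (F := F) (v a)
  exact ⟨N, fun b x hx => apply_eq_zero_of_simple v ha (hN x hx) b⟩

/-- In the union of a chain of extensions every translate of a vector lies in some stage, where
closedness captures it. -/
theorem exists_invariant [IsSimpleModule R A] (v : A →ₗ[R] (X →₀ A)) (h2 : Spread v) :
    ∃ S, F.Invariant R S ∧ NoSingle S ∧ ∀ a, v a ∈ S := by
  obtain ⟨N₀, hN₀⟩ := exists_mem_stage_linearMap (F := F) v
  obtain ⟨S₀, hS₀, hs₀, hvS₀⟩ := exists_closed N₀ v hN₀ h2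
  let P : ℕ → Type _ := fun n => {S : Submodule R (X →₀ A) // F.Closed R (N₀ + n) S ∧ NoSingle S}
  have ext : ∀ n (S : P n), ∃ S' : P (n + 1), S.1 ≤ S'.1 := fun n S => by
    obtain ⟨S', hle, h, h'⟩ := S.2.1.exists_extension S.2.2
    exact ⟨⟨S', h, h'⟩, hle⟩
  choose next hnext using ext
  let S : ∀ n, P n := fun n => Nat.rec ⟨S₀, hS₀, hs₀⟩ next n
  have hmono : Monotone fun n => (S n).1 := monotone_nat_of_le_succ fun n => hnext n (S n)
  have hmem : ∀ {p}, p ∈ (⨆ n, (S n).1) ↔ ∃ n, p ∈ (S n).1 := fun {p} =>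
    Submodule.mem_iSup_of_directed _ hmono.directed_le
  refine ⟨⨆ n, (S n).1, fun i p hp => ?_, fun x a hx => ?_, fun a => hmem.2 ⟨0, hvS₀ a⟩⟩
  · obtain ⟨n, hn⟩ := hmem.1 hp
    obtain ⟨M, hM⟩ := exists_mem_stage (R := R) (F := F) (F.move R A i p)
    exact hmem.2 ⟨max n M, (S (max n M)).2.1.2 i p (hmono (le_max_left _ _) hn)
      (stage_mono (by omega) hM)⟩
  · obtain ⟨n, hn⟩ := hmem.1 hx
    exact (S n).2.2 x a hn

variable (F) in
/-- The smallest invariant submodule that contains the range of `v`. -/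
noncomputable def gen (v : A →ₗ[R] (X →₀ A)) : Submodule R (X →₀ A) :=
  sInf {S | F.Invariant R S ∧ ∀ a, v a ∈ S}

theorem gen_le {v : A →ₗ[R] (X →₀ A)} {S : Submodule R (X →₀ A)} (hS : F.Invariant R S)
    (hv : ∀ a, v a ∈ S) : F.gen v ≤ S := sInf_le ⟨hS, hv⟩

theorem mem_gen (v : A →ₗ[R] (X →₀ A)) (a : A) : v a ∈ F.gen v :=
  Submodule.mem_sInf.2 fun _ hS => hS.2 a

theorem invariant_gen (v : A →ₗ[R] (X →₀ A)) : F.Invariant R (F.gen v) := fun i p hp =>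
  Submodule.mem_sInf.2 fun S hS => hS.1 i p (Submodule.mem_sInf.1 hp S hS)

theorem noSingle_gen [IsSimpleModule R A] {v : A →ₗ[R] (X →₀ A)} (h : Spread v) :
    NoSingle (F.gen v) := by
  obtain ⟨S, hS, hs, hv⟩ := exists_invariant (F := F) v h
  exact fun x a hx => hs x a (gen_le hS hv hx)

end FreeSystem

/-! ### Automorphisms that preserve all invariant hulls -/

namespace FreeSystem

variable {X ι : Type*} {F : FreeSystem X ι} {R : Type*} [Ring R] {A : Type*} [AddCommGroup A]
  [Module R A]

/-- Apply the hypothesis to v = h ∘ single x. Its hull contains h (single x a), hence also single x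
a, so v cannot be spread over two points. -/
theorem exists_point [IsSimpleModule R A] (h : (X →₀ A) ≃ₗ[R] (X →₀ A))
    (hg : ∀ (v : A →ₗ[R] (X →₀ A)) w, w ∈ F.gen v ↔ h w ∈ F.gen v)
    (x : X) : ∃ y, ∀ a, ∃ b, h (Finsupp.single x a) = Finsupp.single y b := by
  have := IsSimpleModule.nontrivial R A
  obtain ⟨a, ha⟩ := exists_ne (0 : A)
  have hv : ∀ b, (h.toLinearMap ∘ₗ Finsupp.lsingle x : A →ₗ[R] (X →₀ A)) b =
    h (Finsupp.single x b) := fun b => rfl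
  have hns : ¬ Spread (h.toLinearMap ∘ₗ Finsupp.lsingle x : A →ₗ[R] (X →₀ A)) := fun hs =>
    ha (noSingle_gen (F := F) hs x a ((hg _ _).2 (hv a ▸ mem_gen _ a)))
  have hne : h (Finsupp.single x a) ≠ 0 := by
    simpa using ha
  obtain ⟨y, hy⟩ := Finsupp.ne_iff.1 hne
  refine ⟨y, fun b => ⟨h (Finsupp.single x b) y, ?_⟩⟩
  ext z
  by_cases hz : z = y
  · subst hz; simp
  · rw [Finsupp.single_eq_of_ne hz]
    by_contra hzb
    exact hns ⟨z, y, hz, ⟨b, hzb⟩, a, hy⟩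

/-- A linear isomorphism that preserves all the submodules `gen v` permutes the basis, up to
changes in the individual coordinates. -/
theorem exists_perm [IsSimpleModule R A] (h : (X →₀ A) ≃ₗ[R] (X →₀ A))
    (hg : ∀ (v : A →ₗ[R] (X →₀ A)) w, w ∈ F.gen v ↔ h w ∈ F.gen v) :
    ∃ θ : Equiv.Perm X, (∀ x a, ∃ b, h (Finsupp.single x a) = Finsupp.single (θ x) b) ∧
      ∀ x a, ∃ b, h.symm (Finsupp.single x a) = Finsupp.single (θ.symm x) b := by
  have := IsSimpleModule.nontrivial R A
  obtain ⟨a, ha⟩ := exists_ne (0 : A)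
  have hg' : ∀ v w, w ∈ F.gen v ↔ h.symm w ∈ F.gen v := fun v w => by
    rw [hg v (h.symm w), h.apply_symm_apply]
  have inv : ∀ (h : (X →₀ A) ≃ₗ[R] (X →₀ A)) (θ θ' : X → X)
      (_ : ∀ x a, ∃ b, h (Finsupp.single x a) = Finsupp.single (θ x) b)
      (_ : ∀ x a, ∃ b, h.symm (Finsupp.single x a) = Finsupp.single (θ' x) b),
      Function.LeftInverse θ' θ := by
    intro h θ θ' hθ hθ' x
    obtain ⟨b, hb⟩ := hθ x a
    obtain ⟨c, hc⟩ := hθ' (θ x) b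
    rw [← hb, h.symm_apply_apply] at hc
    rcases (Finsupp.single_eq_single_iff _ _ _ _).1 hc with h | h
    · exact h.1.symm
    · exact absurd h.1 ha
  choose θ hθ using exists_point h hg
  choose θ' hθ' using exists_point (F := F) h.symm hg'
  exact ⟨⟨θ, θ', inv h θ θ' hθ hθ', inv h.symm θ' θ hθ' hθ⟩, hθ, hθ'⟩

theorem exists_single_ne_zero (h : (X →₀ A) ≃ₗ[R] (X →₀ A)) {θ : X → X}
    (hθ : ∀ x a, ∃ b, h (Finsupp.single x a) = Finsupp.single (θ x) b) {a : A} (ha : a ≠ 0)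
    (x : X) : ∃ b, b ≠ 0 ∧ h (Finsupp.single x a) = Finsupp.single (θ x) b := by
  obtain ⟨b, hb⟩ := hθ x a
  refine ⟨b, ?_, hb⟩
  rintro rfl
  rw [Finsupp.single_zero, LinearEquiv.map_eq_zero_iff, Finsupp.single_eq_zero] at hb
  exact ha hb

/-- The permutation of the basis preserves the equivalence relations respected by the family. -/
theorem perm_respects [IsSimpleModule R A] {h : (X →₀ A) ≃ₗ[R] (X →₀ A)}
    (hg : ∀ (v : A →ₗ[R] (X →₀ A)) w, w ∈ F.gen v ↔ h w ∈ F.gen v)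
    {θ : X → X} (hθ : ∀ x a, ∃ b, h (Finsupp.single x a) = Finsupp.single (θ x) b)
    {B : Type*} {κ : X → B} {g : ι → B → B} (hκ : ∀ i x, κ (F.act i x) = g i (κ x)) {x x' : X}
    (hx : κ x = κ x') : κ (θ x) = κ (θ x') := by
  have := IsSimpleModule.nontrivial R A
  obtain ⟨a, ha⟩ := exists_ne (0 : A)
  -- Pushing forward along κ has an invariant kernel, which contains single x a − single x' a and
  -- therefore the hull of this difference.
  have hinv : F.Invariant R (LinearMap.ker (Finsupp.lmapDomain A R κ)) := by
    intro i p hp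
    rw [LinearMap.mem_ker, Finsupp.lmapDomain_apply] at hp ⊢
    have h1 : F.move R A i p = Finsupp.mapDomain (F.act i) p :=
      Finsupp.equivMapDomain_eq_mapDomain _ _
    have h2 : κ ∘ F.act i = g i ∘ κ := funext fun x => hκ i x
    rw [h1, ← Finsupp.mapDomain_comp, h2, Finsupp.mapDomain_comp, hp, Finsupp.mapDomain_zero]
  have hle := gen_le (v := (Finsupp.lsingle x - Finsupp.lsingle x' : A →ₗ[R] (X →₀ A))) hinv
    (fun b => by simp [Finsupp.mapDomain_sub, Finsupp.mapDomain_single, hx])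
  have hmem := hle ((hg _ _).1 (mem_gen _ a))
  obtain ⟨b, hb, e⟩ := exists_single_ne_zero h hθ ha x
  obtain ⟨b', hb', e'⟩ := exists_single_ne_zero h hθ ha x'
  simp only [LinearMap.sub_apply, Finsupp.lsingle_apply, map_sub, e, e', LinearMap.mem_ker,
    Finsupp.lmapDomain_apply, Finsupp.mapDomain_single, sub_eq_zero] at hmem
  rcases (Finsupp.single_eq_single_iff _ _ _ _).1 hmem with h | h
  · exact h.1
  · exact absurd h.1 hb

/-- The permutation of the basis preserves the functions invariant under the family. -/
theorem perm_invariant [IsSimpleModule R A] {h : (X →₀ A) ≃ₗ[R] (X →₀ A)}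
    (hg : ∀ (v : A →ₗ[R] (X →₀ A)) w, w ∈ F.gen v ↔ h w ∈ F.gen v)
    {θ : X → X} (hθ : ∀ x a, ∃ b, h (Finsupp.single x a) = Finsupp.single (θ x) b)
    {B : Type*} {κ : X → B} (hκ : ∀ i x, κ (F.act i x) = κ x) (x : X) : κ (θ x) = κ x := by
  have := IsSimpleModule.nontrivial R A
  obtain ⟨a, ha⟩ := exists_ne (0 : A)
  have hinv : F.Invariant R (Finsupp.supported A R {z | κ z = κ x}) := by
    intro i p hp
    rw [Finsupp.mem_supported'] at hp ⊢
    intro z hz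
    rw [move_apply]
    refine hp _ fun hz' => hz ?_
    have := hκ i (F.act (F.inv i) z)
    rw [act_act_inv] at this
    exact this.trans hz'
  have hle := gen_le (v := (Finsupp.lsingle x : A →ₗ[R] (X →₀ A))) hinv
    (fun b => Finsupp.single_mem_supported R b rfl)
  have hmem := hle ((hg _ _).1 (mem_gen _ a))
  obtain ⟨b, hb, e⟩ := exists_single_ne_zero h hθ ha x
  rw [Finsupp.lsingle_apply, e, Finsupp.mem_supported'] at hmem
  by_contra hne
  have := hmem (θ x) hne
  rw [Finsupp.single_eq_same] at this
  exact hb this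

theorem mapDomain_mem_of_mem_closure {S : Submodule R (X →₀ A)} (hS : F.Invariant R S)
    {γ : Equiv.Perm X} (hγ : γ ∈ Subgroup.closure (Set.range F.act)) {p : X →₀ A} (hp : p ∈ S) :
    Finsupp.mapDomain γ p ∈ S := by
  induction hγ using Subgroup.closure_induction'' generalizing p with
  | one => simpa using hp
  | mem γ hγ =>
    obtain ⟨i, rfl⟩ := hγ
    have := hS i p hp
    rwa [move, Finsupp.domLCongr_apply, Finsupp.domCongr_apply,
      Finsupp.equivMapDomain_eq_mapDomain] at this
  | inv_mem γ hγ =>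
    obtain ⟨i, rfl⟩ := hγ
    have := hS (F.inv i) p hp
    rwa [move, Finsupp.domLCongr_apply, Finsupp.domCongr_apply, F.act_inv,
      Finsupp.equivMapDomain_eq_mapDomain] at this
  | mul γ γ' _ _ h h' =>
    rw [Equiv.Perm.coe_mul, Finsupp.mapDomain_comp]
    exact h (h' hp)

/-- A vector has finite support, so τ acts on it as a single element of the group. -/
theorem mapDomain_mem_of_local {S : Submodule R (X →₀ A)} (hS : F.Invariant R S)
    {τ : X → X} (hτ : ∀ s : Finset X, ∃ γ ∈ Subgroup.closure (Set.range F.act), ∀ x ∈ s, τ x = γ x)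
    {p : X →₀ A} (hp : p ∈ S) : Finsupp.mapDomain τ p ∈ S := by
  obtain ⟨γ, hγ, h⟩ := hτ p.support
  rw [Finsupp.mapDomain_congr h]
  exact mapDomain_mem_of_mem_closure hS hγ hp

end FreeSystem

/-! ### Reduced words acting on labelled points -/

/-- Labels of points: a code and a tuple of natural numbers. -/
abbrev Label := ℕ × List ℕ

/-- The action of a permutation of `ℕ` on labels. -/
def relabel (σ : ℕ → ℕ) (u : Label) : Label := (u.1, u.2.map σ)

/-- A letter `(L, i, j, b)` stands for a generic transformation, or its inverse, that induces the
transposition of `i` and `j` on labels and fixes the points with rank in `L`. -/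
abbrev Letter := List ℕ × ℕ × ℕ × Bool

namespace Letter

/-- The inverse letter. -/
def flip (e : Letter) : Letter := (e.1, e.2.1, e.2.2.1, !e.2.2.2)

/-- The induced transposition. -/
def swap (e : Letter) : Equiv.Perm ℕ := Equiv.swap e.2.1 e.2.2.1

@[simp] theorem flip_flip (e : Letter) : e.flip.flip = e := by simp [flip]

@[simp] theorem fst_flip (e : Letter) : e.flip.1 = e.1 := rfl

@[simp] theorem swap_flip (e : Letter) : e.flip.swap = e.swap := rfl

theorem flip_ne (e : Letter) : e.flip ≠ e := fun h => by
  have : (!e.2.2.2) = e.2.2.2 := congrArg (fun e : Letter => e.2.2.2) h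
  simp at this

end Letter

/-- Words of letters applied to a base point given by its label. -/
abbrev Word := List Letter × Label

namespace Word

/-- An injective rank function. -/
def rank (p : Word) : ℕ := Encodable.encode p

/-- The label of a word. -/
def label (p : Word) : Label := p.1.foldr (fun e u => relabel e.swap u) p.2

@[simp] theorem label_cons (e : Letter) (l : List Letter) (u : Label) :
    label (e :: l, u) = relabel e.swap (label (l, u)) := rfl

theorem rank_lt_cons (e : Letter) (l : List Letter) (u : Label) :
    rank (l, u) < rank (e :: l, u) := by
  simp only [rank, Encodable.encode_prod_val, Encodable.encode_list_cons]
  exact Nat.pair_lt_pair_left _ (Nat.lt_succ_of_le (Nat.right_le_pair _ _))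

/-- Together with `lt_encode_of_mem` this makes `encode e.1` a threshold: points fixed by e lie
below it, words beginning with e or its inverse do not. -/
theorem encode_le_rank_cons (e : Letter) (l : List Letter) (u : Label) :
    Encodable.encode e.1 ≤ rank (e :: l, u) := by
  have h1 : rank (e :: l, u) = Nat.pair (Nat.succ (Nat.pair (Encodable.encode e)
      (Encodable.encode l))) (Encodable.encode u) := rfl
  have h2 : Encodable.encode e = Nat.pair (Encodable.encode e.1) (Encodable.encode e.2) := rfl
  have h3 := Nat.left_le_pair (Encodable.encode e.1) (Encodable.encode e.2)
  have h4 := Nat.left_le_pair (Encodable.encode e) (Encodable.encode l)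
  have h5 := Nat.left_le_pair (Nat.succ (Nat.pair (Encodable.encode e) (Encodable.encode l)))
    (Encodable.encode u)
  omega

theorem lt_encode_of_mem {n : ℕ} {L : List ℕ} (h : n ∈ L) : n < Encodable.encode L := by
  induction L with
  | nil => simp at h
  | cons m L ih =>
    rw [Encodable.encode_list_cons]
    have h1 := Nat.left_le_pair (Encodable.encode m) (Encodable.encode L)
    have h2 := Nat.right_le_pair (Encodable.encode m) (Encodable.encode L)
    have h3 : Encodable.encode m = m := rfl
    rcases List.mem_cons.1 h with rfl | h
    · omega
    · have := ih h
      omega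

end Word

/-- A letter is valid if its transposition fixes the labels of the points that the letter fixes. -/
def Letter.Valid (e : Letter) : Prop := ∀ p : Word, p.rank ∈ e.1 → relabel e.swap p.label = p.label

theorem Letter.Valid.flip {e : Letter} (h : e.Valid) : e.flip.Valid := h

/-- Reduced words. -/
def Reduced (u : Label) : List Letter → Prop
  | [] => True
  | e :: l => Reduced u l ∧ e.Valid ∧ Word.rank (l, u) ∉ e.1 ∧ l.head? ≠ some e.flip

/-- The set of points. -/
abbrev Point := {p : Word // Reduced p.2 p.1}

open Classical in
/-- The action of a letter on words. -/
noncomputable def Letter.apply (e : Letter) (p : Word) : Word :=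
  if p.rank ∈ e.1 then p else if p.1.head? = some e.flip then (p.1.tail, p.2) else (e :: p.1, p.2)

namespace Letter

theorem apply_of_mem {e : Letter} {p : Word} (h : p.rank ∈ e.1) : e.apply p = p := if_pos h

theorem notMem_cons {e e' : Letter} (h : e'.1 = e.1) (l : List Letter) (u : Label) :
    Word.rank (e' :: l, u) ∉ e.1 := fun hm => by
  have h1 := Word.lt_encode_of_mem hm
  have h2 := Word.encode_le_rank_cons e' l u
  rw [h] at h2
  omega

theorem apply_flip_cons (e : Letter) (l : List Letter) (u : Label) :
    e.apply (e.flip :: l, u) = (l, u) := by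
  rw [apply, if_neg (notMem_cons (fst_flip e) l u), if_pos (by simp)]
  rfl

theorem apply_eq_cons {e : Letter} {p : Word} (h : p.rank ∉ e.1) (h' : p.1.head? ≠ some e.flip) :
    e.apply p = (e :: p.1, p.2) := by
  rw [apply, if_neg h, if_neg h']

theorem eq_of_head {e : Letter} {p : Word} (h : p.1.head? = some e) :
    ∃ l, p = (e :: l, p.2) := by
  obtain ⟨l, u⟩ := p
  cases l with
  | nil => simp at h
  | cons e' l =>
    simp only [List.head?_cons, Option.some.injEq] at h
    exact ⟨l, by rw [h]⟩

/-- The three possible effects of a letter on a word. -/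
theorem apply_cases (e : Letter) (p : Word) :
    (p.rank ∈ e.1 ∧ e.apply p = p) ∨
    (p.rank ∉ e.1 ∧ ∃ l, p = (e.flip :: l, p.2) ∧ e.apply p = (l, p.2)) ∨
    (p.rank ∉ e.1 ∧ p.1.head? ≠ some e.flip ∧ e.apply p = (e :: p.1, p.2)) := by
  by_cases h : p.rank ∈ e.1
  · exact .inl ⟨h, apply_of_mem h⟩
  · by_cases h' : p.1.head? = some e.flip
    · obtain ⟨l, hl⟩ := eq_of_head h'
      refine .inr (.inl ⟨h, l, hl, ?_⟩)
      conv_lhs => rw [hl]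
      exact apply_flip_cons e l _
    · exact .inr (.inr ⟨h, h', apply_eq_cons h h'⟩)

theorem reduced_apply {e : Letter} (he : e.Valid) {p : Word} (hp : Reduced p.2 p.1) :
    Reduced (e.apply p).2 (e.apply p).1 := by
  rcases apply_cases e p with ⟨-, h⟩ | ⟨-, l, h, h'⟩ | ⟨h1, h2, h⟩
  · rwa [h]
  · rw [h] at hp
    rw [h']
    exact hp.1
  · rw [h]
    exact ⟨hp, he, h1, h2⟩

theorem apply_flip_apply {e : Letter} {p : Word} (hp : Reduced p.2 p.1) :
    e.flip.apply (e.apply p) = p := by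
  rcases apply_cases e p with ⟨h0, h⟩ | ⟨-, l, h, h'⟩ | ⟨h1, h2, h⟩
  · rw [h]
    exact apply_of_mem h0
  · rw [h] at hp
    rw [h', apply_eq_cons hp.2.2.1 hp.2.2.2]
    exact h.symm
  · rw [h]
    have := apply_flip_cons e.flip p.1 p.2
    rwa [flip_flip] at this

theorem relabel_swap_swap (e : Letter) (u : Label) : relabel e.swap (relabel e.swap u) = u := by
  simp [relabel, swap, Function.comp_def]

theorem label_apply {e : Letter} (he : e.Valid) (p : Word) :
    (e.apply p).label = relabel e.swap p.label := by
  rcases apply_cases e p with ⟨h0, h⟩ | ⟨-, l, h, h'⟩ | ⟨h1, h2, h⟩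
  · rw [h, he p h0]
  · rw [h']
    conv_rhs => rw [h]
    rw [Word.label_cons, swap_flip, relabel_swap_swap]
  · rw [h]
    rfl

end Letter

/-- The permutation of the points induced by a valid letter. -/
noncomputable def pointAct (e : {e : Letter // e.Valid}) : Equiv.Perm Point where
  toFun p := ⟨e.1.apply p.1, Letter.reduced_apply e.2 p.2⟩
  invFun p := ⟨e.1.flip.apply p.1, Letter.reduced_apply e.2.flip p.2⟩
  left_inv p := Subtype.ext (Letter.apply_flip_apply p.2)
  right_inv p := Subtype.ext (by
    have := Letter.apply_flip_apply (e := e.1.flip) p.2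
    rwa [Letter.flip_flip] at this)

/-- The points with the action of the letters. -/
noncomputable def pointSystem : FreeSystem Point {e : Letter // e.Valid} where
  rank p := p.1.rank
  rank_injective := Encodable.encode_injective.comp Subtype.val_injective
  act := pointAct
  inv e := ⟨e.1.flip, e.2.flip⟩
  inv_ne e h := Letter.flip_ne e.1 (congrArg Subtype.val h)
  inv_inv e := Subtype.ext (Letter.flip_flip e.1)
  act_inv e := by
    refine Equiv.ext fun p => ?_
    rfl
  thr e := Encodable.encode e.1.1
  act_of_lt := by
    intro e p h
    rcases Letter.apply_cases e.1 p.1 with ⟨-, h'⟩ | ⟨-, l, hl, -⟩ | ⟨-, -, h'⟩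
    · exact .inl (Subtype.ext h')
    · have := Word.encode_le_rank_cons e.1.flip l p.1.2
      rw [← hl, Letter.fst_flip] at this
      omega
    · right
      change _ ≤ (e.1.apply p.1).rank
      rw [h']
      exact Word.encode_le_rank_cons _ _ _
  act_ne := by
    intro e p h heq
    have heq' : e.1.apply p.1 = p.1 := congrArg Subtype.val heq
    rcases Letter.apply_cases e.1 p.1 with ⟨h', -⟩ | ⟨-, l, hl, h'⟩ | ⟨-, -, h'⟩
    · have := Word.lt_encode_of_mem h'
      omega
    · rw [h', hl] at heq'
      have := congrArg (fun q : Word => q.1.length) heq'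
      simp at this
    · rw [h'] at heq'
      have := congrArg (fun q : Word => q.1.length) heq'
      simp at this
  descent := by
    -- The rank drops only through cancellation, and the cancelled first letter determines e.
    have key : ∀ (e : {e : Letter // e.Valid}) (p : Point),
        (pointAct e p).1.rank < p.1.rank → p.1.1.head? = some e.1.flip := by
      intro e p h
      change (e.1.apply p.1).rank < _ at h
      rcases Letter.apply_cases e.1 p.1 with ⟨-, h'⟩ | ⟨-, l, hl, -⟩ | ⟨-, -, h'⟩
      · rw [h'] at h
        exact absurd h (lt_irrefl _)
      · rw [hl]
        rfl
      · rw [h'] at h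
        exact absurd h (not_lt.2 (Word.rank_lt_cons _ _ _).le)
    intro e e' p h h'
    have := (key e p h).symm.trans (key e' p h')
    rw [Option.some.injEq] at this
    refine Subtype.ext ?_
    rw [← Letter.flip_flip e.1, this, Letter.flip_flip]

/-- The label of a point. -/
def pointLabel (p : Point) : Label := p.1.label

theorem pointLabel_act (e : {e : Letter // e.Valid}) (p : Point) :
    pointLabel (pointSystem.act e p) = relabel e.1.swap (pointLabel p) := Letter.label_apply e.2 p.1

/-- The point given by a label. -/
def basePoint (u : Label) : Point := ⟨([], u), trivial⟩

@[simp] theorem pointLabel_basePoint (u : Label) : pointLabel (basePoint u) = u := rfl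

/-! ### Lifting permutations of `ℕ` to the points -/

theorem relabel_congr {σ τ : ℕ → ℕ} {u : Label} (h : ∀ n ∈ u.2, σ n = τ n) :
    relabel σ u = relabel τ u := by
  simp only [relabel, Prod.mk.injEq, true_and]
  exact List.map_congr_left h

theorem relabel_relabel (σ τ : ℕ → ℕ) (u : Label) :
    relabel σ (relabel τ u) = relabel (σ ∘ τ) u := by
  simp [relabel]

theorem relabel_injective {σ : ℕ → ℕ} (h : Function.Injective σ) :
    Function.Injective (relabel σ) := by
  rintro ⟨c, a⟩ ⟨c', a'⟩ e
  simp only [relabel, Prod.mk.injEq] at e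
  exact Prod.ext e.1 (List.map_injective_iff.2 h e.2)

/-- A product of letters, together with the induced permutation of `ℕ`. -/
structure WordPerm where
  perm : Equiv.Perm Point
  base : Equiv.Perm ℕ
  mem : perm ∈ Subgroup.closure (Set.range pointSystem.act)
  label : ∀ x, pointLabel (perm x) = relabel base (pointLabel x)

namespace WordPerm

/-- The product of a word with a letter. -/
noncomputable def snoc (g : WordPerm) (e : {e : Letter // e.Valid}) : WordPerm where
  perm := g.perm * pointSystem.act e
  base := g.base * e.1.swap
  mem := mul_mem g.mem (Subgroup.subset_closure ⟨e, rfl⟩)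
  label x := by
    rw [Equiv.Perm.mul_apply, g.label, pointLabel_act, relabel_relabel]
    rfl

/-- The trivial product. -/
def one : WordPerm := ⟨1, 1, one_mem _, fun x => by simp [relabel]⟩

/-- Wrong values of the base are corrected one at a time: a letter inducing a transposition and
fixing Y is composed on the right, so it acts first and leaves the values on Y unchanged. -/
theorem exists_extension (σ : Equiv.Perm ℕ) (Y : Finset Point) (B : Finset ℕ) (g : WordPerm)
    (hg : ∀ y ∈ Y, ∀ n ∈ (pointLabel y).2, g.base n = σ n) :
    ∃ g' : WordPerm, (∀ y ∈ Y, g'.perm y = g.perm y) ∧ (∀ n ∈ B, g'.base n = σ n) ∧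
      ∀ y ∈ Y, ∀ n ∈ (pointLabel y).2, g'.base n = σ n := by
  induction B using Finset.induction with
  | empty => exact ⟨g, fun _ _ => rfl, by simp, hg⟩
  | insert b B _ ih =>
    obtain ⟨h, h1, h2, h3⟩ := ih
    by_cases hb : h.base b = σ b
    · refine ⟨h, h1, fun n hn => ?_, h3⟩
      rcases Finset.mem_insert.1 hn with rfl | hn
      · exact hb
      · exact h2 n hn
    set c := h.base.symm (σ b) with hc
    have hcb : h.base c = σ b := by simp [hc]
    -- Numbers where the base is already correct differ from both b and c. This makes the new letter
    -- valid and preserves earlier corrections.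
    have fix : ∀ n, h.base n = σ n → Equiv.swap b c n = n := fun n hn =>
      Equiv.swap_apply_of_ne_of_ne (by rintro rfl; exact hb hn) (by
        rintro rfl
        rw [hcb] at hn
        rw [σ.injective hn] at hcb
        apply hb
        rw [σ.injective hn, hcb])
    let e : Letter := (Y.toList.map fun y => y.1.rank, b, c, true)
    have he : e.Valid := by
      intro p hp
      obtain ⟨y, hy, hyp⟩ := List.mem_map.1 hp
      have : y.1 = p := Encodable.encode_injective hyp
      subst this
      have : relabel (Equiv.swap b c) y.1.label = relabel id y.1.label :=
        relabel_congr fun n hn => fix n (h3 y (Finset.mem_toList.1 hy) n hn)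
      exact this.trans (by simp [relabel])
    have hs : ∀ n, h.base n = σ n → (h.snoc ⟨e, he⟩).base n = σ n := fun n hn => by
      change h.base (Equiv.swap b c n) = σ n
      rw [fix n hn, hn]
    refine ⟨h.snoc ⟨e, he⟩, fun y hy => ?_, fun n hn => ?_, fun y hy n hn => hs n (h3 y hy n hn)⟩
    · rw [← h1 y hy]
      change h.perm (pointAct ⟨e, he⟩ y) = h.perm y
      congr 1
      refine Subtype.ext (Letter.apply_of_mem ?_)
      exact List.mem_map.2 ⟨y, Finset.mem_toList.2 hy, rfl⟩
    · rcases Finset.mem_insert.1 hn with rfl | hn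
      · change h.base (Equiv.swap n c n) = σ n
        rw [Equiv.swap_apply_left, hcb]
      · exact hs n (h2 n hn)

/-- Approximations to a lift of `σ`: a product of letters and a finite set of points where it
agrees with the lift. -/
abbrev Approx (σ : Equiv.Perm ℕ) :=
  {s : WordPerm × Finset Point // ∀ y ∈ s.2, ∀ n ∈ (pointLabel y).2, s.1.base n = σ n}

open Classical in
theorem Approx.exists_extension {σ : Equiv.Perm ℕ} (s : Approx σ) (x : Point) :
    ∃ t : Approx σ, s.1.2 ⊆ t.1.2 ∧ (∀ y ∈ s.1.2, t.1.1.perm y = s.1.1.perm y) ∧ x ∈ t.1.2 ∧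
      ∃ z ∈ t.1.2, t.1.1.perm z = x := by
  obtain ⟨⟨g, Y⟩, hg⟩ := s
  -- The σ-preimages of the entries of x are included because they will be the entries of the
  -- preimage of x under g'.
  obtain ⟨g', h1, h2, h3⟩ := WordPerm.exists_extension σ Y
    ((pointLabel x).2.toFinset ∪ ((pointLabel x).2.map σ.symm).toFinset) g hg
  refine ⟨⟨(g', insert x (insert (g'.perm.symm x) Y)), ?_⟩, ?_, h1, by simp,
    g'.perm.symm x, by simp, by simp⟩
  · intro y hy n hn
    rcases Finset.mem_insert.1 hy with rfl | hy
    · exact h2 n (by simp [hn])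
    rcases Finset.mem_insert.1 hy with rfl | hy
    · have hl := g'.label (g'.perm.symm x)
      rw [Equiv.apply_symm_apply] at hl
      have hn' : g'.base n ∈ (pointLabel x).2 := by
        rw [hl]
        exact List.mem_map_of_mem hn
      have h4 := h2 (σ.symm (g'.base n)) (by
        simp only [Finset.mem_union, List.mem_toFinset, List.mem_map]
        exact .inr ⟨_, hn', rfl⟩)
      rw [Equiv.apply_symm_apply] at h4
      have h5 := g'.base.injective h4
      change g'.base n = σ n
      conv_rhs => rw [← h5]
      simp
    · exact h3 y hy n hn
  · intro y hy
    simp only [Finset.mem_insert]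
    exact .inr (.inr hy)

end WordPerm

instance : Nonempty Point := ⟨basePoint (0, [])⟩

/-- Every permutation of `ℕ` lifts to a permutation of the points that locally is a product of
letters. -/
theorem exists_lift (σ : Equiv.Perm ℕ) : ∃ τ : Equiv.Perm Point,
    (∀ x, pointLabel (τ x) = relabel σ (pointLabel x)) ∧
    ∀ s : Finset Point, ∃ γ ∈ Subgroup.closure (Set.range pointSystem.act), ∀ x ∈ s, τ x = γ x := by
  obtain ⟨e, he⟩ := exists_surjective_nat Point
  choose next hsub hagree hmem hsurj using
    fun (s : WordPerm.Approx σ) x => s.exists_extension x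
  let s : ℕ → WordPerm.Approx σ := fun n =>
    Nat.rec ⟨(WordPerm.one, ∅), by simp⟩ (fun n t => next t (e n)) n
  have hmono : Monotone fun n => (s n).1.2 := monotone_nat_of_le_succ fun n => hsub (s n) (e n)
  have hag : ∀ {m n}, m ≤ n → ∀ y ∈ (s m).1.2, (s n).1.1.perm y = (s m).1.1.perm y := by
    intro m n hmn
    induction n, hmn using Nat.le_induction with
    | base => exact fun _ _ => rfl
    | succ n hmn ih =>
      intro y hy
      rw [← ih y hy]
      exact hagree (s n) (e n) y (hmono hmn hy)
  have hex : ∀ x, ∃ n, x ∈ (s n).1.2 := fun x => by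
    obtain ⟨n, rfl⟩ := he x
    exact ⟨n + 1, hmem (s n) (e n)⟩
  choose N hN using hex
  let f : Point → Point := fun x => (s (N x)).1.1.perm x
  have hf : ∀ {n x}, x ∈ (s n).1.2 → f x = (s n).1.1.perm x := fun {n x} hx => by
    rw [← hag (le_max_left n (N x)) x hx]
    exact (hag (le_max_right n (N x)) x (hN x)).symm
  have hinj : Function.Injective f := fun x y h => by
    rw [hf (hmono (le_max_left (N x) (N y)) (hN x)),
      hf (hmono (le_max_right (N x) (N y)) (hN y))] at h
    exact (Equiv.injective _) h
  have hsurj' : Function.Surjective f := fun x => by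
    obtain ⟨n, rfl⟩ := he x
    obtain ⟨z, hz, hzx⟩ := hsurj (s n) (e n)
    exact ⟨z, (hf (n := n + 1) hz).trans hzx⟩
  refine ⟨Equiv.ofBijective f ⟨hinj, hsurj'⟩, fun x => ?_, fun t => ?_⟩
  · refine ((s (N x)).1.1.label x).trans ?_
    exact relabel_congr ((s (N x)).2 x (hN x))
  · refine ⟨(s (t.sup N)).1.1.perm, (s (t.sup N)).1.1.mem, fun x hx => ?_⟩
    exact hf (hmono (Finset.le_sup (f := N) hx) (hN x))

/-! ### Coding sets of labels by modules with an endomorphism -/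

section Code

variable {R : Type*} [Ring R] {A : Type*} [AddCommGroup A] [Module R A] [IsSimpleModule R A]

/-- The entry of a label at position `i`; labels `(0, [n])` stand for `n` itself. -/
def labelEntry (i : ℕ) (u : Label) : Option ℕ :=
  if u.1 = 0 ∧ u.2.length = 1 then u.2[0]? else u.2[i]?

theorem labelEntry_relabel (i : ℕ) (σ : ℕ → ℕ) (u : Label) :
    labelEntry i (relabel σ u) = (labelEntry i u).map σ := by
  simp only [labelEntry, relabel, List.length_map, List.getElem?_map]
  split_ifs <;> rfl

theorem labelEntry_of_getElem? {i m : ℕ} {u : Label} (h : u.2[i]? = some m) :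
    labelEntry i u = some m := by
  unfold labelEntry
  split_ifs with hu
  · have := (List.getElem?_eq_some_iff.1 h).1
    have hi : i = 0 := by omega
    rwa [hi] at h
  · exact h

theorem getElem?_of_labelEntry {i m : ℕ} {u : Label} (h : labelEntry i u = some m)
    (hi : i < u.2.length) : u.2[i]? = some m := by
  obtain ⟨k, hk⟩ : ∃ k, u.2[i]? = some k := ⟨_, List.getElem?_eq_getElem hi⟩
  rw [hk, ← h, labelEntry_of_getElem? hk]

/-- Code and length of a label are invariant under the letters, and equality of i-th entries is
respected by them; hence θ preserves both. -/
theorem exists_relabel {h : (Point →₀ A) ≃ₗ[R] (Point →₀ A)}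
    (hg : ∀ (v : A →ₗ[R] (Point →₀ A)) w, w ∈ pointSystem.gen v ↔ h w ∈ pointSystem.gen v)
    {θ : Point → Point} (hθ : ∀ x a, ∃ b, h (Finsupp.single x a) = Finsupp.single (θ x) b) :
    ∃ s : ℕ → ℕ, ∀ x, pointLabel (θ x) = relabel s (pointLabel x) := by
  have hsort : ∀ x, ((pointLabel (θ x)).1, (pointLabel (θ x)).2.length) =
      ((pointLabel x).1, (pointLabel x).2.length) :=
    FreeSystem.perm_invariant hg hθ (κ := fun x => ((pointLabel x).1, (pointLabel x).2.length))
      fun i x => by simp only [pointLabel_act, relabel, List.length_map]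
  have hentry : ∀ i x x', labelEntry i (pointLabel x) = labelEntry i (pointLabel x') →
      labelEntry i (pointLabel (θ x)) = labelEntry i (pointLabel (θ x')) := fun i x x' =>
    FreeSystem.perm_respects hg hθ (κ := fun x => labelEntry i (pointLabel x))
      (g := fun e => Option.map e.1.swap) fun e x => by
        simp only [pointLabel_act, labelEntry_relabel]
  have hbase : ∀ m, ∃ k, pointLabel (θ (basePoint (0, [m]))) = (0, [k]) := fun m => by
    have h1 := hsort (basePoint (0, [m]))
    rw [pointLabel_basePoint, Prod.mk.injEq] at h1
    obtain ⟨k, hk⟩ := List.length_eq_one_iff.1 h1.2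
    exact ⟨k, Prod.ext h1.1 hk⟩
  choose s hs using hbase
  refine ⟨s, fun x => ?_⟩
  have hx := hsort x
  rw [Prod.mk.injEq] at hx
  refine Prod.ext hx.1 (List.ext_getElem? fun i => ?_)
  simp only [relabel, List.getElem?_map]
  by_cases hi : i < (pointLabel x).2.length
  · obtain ⟨m, hm⟩ : ∃ m, (pointLabel x).2[i]? = some m := ⟨_, List.getElem?_eq_getElem hi⟩
    -- Since `labelEntry` reads (0, [m]) as m at every position, one function s serves all
    -- positions.
    have h1 := hentry i x (basePoint (0, [m])) (by
      rw [labelEntry_of_getElem? hm]; simp [labelEntry])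
    rw [hs m] at h1
    rw [hm, getElem?_of_labelEntry (h1.trans (by simp [labelEntry] : _ = some (s m)))
      (hx.2.symm ▸ hi)]
    rfl
  · rw [List.getElem?_eq_none (by omega), List.getElem?_eq_none (by omega)]
    rfl

instance countable_linearMap [Countable A] : Countable (A →ₗ[R] (Point →₀ A)) := by
  have := IsSimpleModule.nontrivial R A
  obtain ⟨a, ha⟩ := exists_ne (0 : A)
  -- By simplicity a linear map is determined by its value at one nonzero vector.
  refine Function.Injective.countable (f := fun v : A →ₗ[R] (Point →₀ A) => v a) fun v w h => ?_
  ext b x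
  have := FreeSystem.apply_eq_zero_of_simple (v - w) (x := x) ha (by simp [h]) b
  simpa [sub_eq_zero] using this

variable (R A) in
/-- An enumeration of the linear maps whose invariant hulls are coded. -/
noncomputable def columns [Countable A] : ℕ → (A →ₗ[R] (Point →₀ A)) :=
  (exists_surjective_nat _).choose

theorem columns_surjective [Countable A] : Function.Surjective (columns R A) :=
  (exists_surjective_nat _).choose_spec

variable (R A) in
/-- The family of submodules that codes a set of labels. -/
noncomputable def codeFamily [Countable A] (D : Set Label) : ℕ → Submodule R (Point →₀ A)
  | 0 => Finsupp.supported A R {x | pointLabel x ∈ D}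
  | 1 => ⊤
  | n + 2 => pointSystem.gen (columns R A n)

/-- A local product of letters that induces `σ`. -/
def IsLift (σ : ℕ → ℕ) (τ : Equiv.Perm Point) : Prop :=
  (∀ x, pointLabel (τ x) = relabel σ (pointLabel x)) ∧
    ∀ s : Finset Point, ∃ γ ∈ Subgroup.closure (Set.range pointSystem.act), ∀ x ∈ s, τ x = γ x

open Classical in
theorem IsLift.symm {σ : Equiv.Perm ℕ} {τ : Equiv.Perm Point} (h : IsLift σ τ) :
    IsLift σ.symm τ.symm := by
  refine ⟨fun x => relabel_injective σ.injective ?_, fun s => ?_⟩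
  · rw [← h.1, Equiv.apply_symm_apply, relabel_relabel]
    simp [relabel]
  · obtain ⟨γ, hγ, hs⟩ := h.2 (s.image τ.symm)
    refine ⟨γ⁻¹, inv_mem hγ, fun x hx => ?_⟩
    rw [Equiv.Perm.eq_inv_iff_eq, ← hs _ (Finset.mem_image_of_mem _ hx), Equiv.apply_symm_apply]

theorem IsLift.mem_codeFamily [Countable A] {σ : ℕ → ℕ} {τ : Equiv.Perm Point} (h : IsLift σ τ)
    {D D' : Set Label} (hD : ∀ u ∈ D, relabel σ u ∈ D') (n : ℕ) (w : Point →₀ A)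
    (hw : w ∈ codeFamily R A D n) :
    (Finsupp.domLCongr (R := R) τ) w ∈ codeFamily R A D' n := by
  have he : (Finsupp.domLCongr (R := R) τ) w = Finsupp.mapDomain τ w :=
    Finsupp.equivMapDomain_eq_mapDomain _ _
  match n with
  | 0 =>
    rw [he]
    rw [codeFamily, Finsupp.mem_supported] at hw ⊢
    intro x hx
    classical
    obtain ⟨y, hy, rfl⟩ := Finset.mem_image.1 (Finsupp.mapDomain_support hx)
    change pointLabel (τ y) ∈ D'
    rw [h.1]
    exact hD _ (hw hy)
  | 1 => exact Submodule.mem_top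
  | n + 2 =>
    rw [he]
    exact FreeSystem.mapDomain_mem_of_local (FreeSystem.invariant_gen _) h.2 hw

variable (R A) in
/-- The set `D` of labels and its image under a permutation of `ℕ` are exactly the sets coded by
isomorphic modules with endomorphism. -/
theorem seqSpace_codeFamily_equiv_iff [Countable A] (D D' : Set Label) :
    (∃ φ : seqSpace (codeFamily R A D) ≃ₗ[R] seqSpace (codeFamily R A D'),
      ∀ v w : seqSpace (codeFamily R A D), (w : ℕ → Point →₀ A) = seqShift (Point →₀ A) v →
        (φ w : ℕ → Point →₀ A) = seqShift (Point →₀ A) (φ v)) ↔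
    ∃ σ : Equiv.Perm ℕ, ∀ u, u ∈ D ↔ relabel σ u ∈ D' := by
  constructor
  · rintro ⟨φ, hφ⟩
    obtain ⟨h, hh⟩ := exists_equiv_of_seqSpace_equiv (m := 1) rfl rfl φ hφ
    have hg : ∀ (v : A →ₗ[R] (Point →₀ A)) w,
        w ∈ pointSystem.gen v ↔ h w ∈ pointSystem.gen v := fun v w => by
      obtain ⟨n, rfl⟩ := columns_surjective v
      exact hh (n + 2) w
    have hg' : ∀ (v : A →ₗ[R] (Point →₀ A)) w,
        w ∈ pointSystem.gen v ↔ h.symm w ∈ pointSystem.gen v := fun v w => by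
      rw [hg v (h.symm w), h.apply_symm_apply]
    obtain ⟨θ, hθ, hθ'⟩ := FreeSystem.exists_perm h hg
    obtain ⟨s, hs⟩ := exists_relabel hg hθ
    obtain ⟨s', hs'⟩ := exists_relabel hg' hθ'
    have h1 : Function.LeftInverse s' s := fun m => by
      have := hs' (θ (basePoint (0, [m])))
      rw [hs, θ.symm_apply_apply, pointLabel_basePoint] at this
      simpa [relabel] using this.symm
    have h2 : Function.LeftInverse s s' := fun m => by
      have := hs (θ.symm (basePoint (0, [m])))
      rw [hs', θ.apply_symm_apply, pointLabel_basePoint] at this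
      simpa [relabel] using this.symm
    refine ⟨⟨s, s', h1, h2⟩, fun u => ?_⟩
    have := IsSimpleModule.nontrivial R A
    obtain ⟨a, ha⟩ := exists_ne (0 : A)
    obtain ⟨b, hb, e⟩ := FreeSystem.exists_single_ne_zero h hθ ha (basePoint u)
    have key : ∀ (D : Set Label) (x : Point) (a : A), a ≠ 0 →
        (Finsupp.single x a ∈ codeFamily R A D 0 ↔ pointLabel x ∈ D) := fun D x a ha => by
      rw [codeFamily, Finsupp.mem_supported, Finsupp.support_single _ ha]
      simp
    have h3 := hh 0 (Finsupp.single (basePoint u) a)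
    rw [e, key _ _ _ ha, key _ _ _ hb, hs] at h3
    exact h3
  · rintro ⟨σ, hσ⟩
    obtain ⟨τ, hτ⟩ := exists_lift σ
    replace hτ : IsLift σ τ := hτ
    have h1 := hτ.mem_codeFamily (R := R) (A := A) (fun u hu => (hσ u).1 hu)
    have h2 := hτ.symm.mem_codeFamily (R := R) (A := A) (D := D') (D' := D) (fun u hu => by
      rw [hσ, relabel_relabel]
      simpa [relabel] using hu)
    refine ⟨LinearEquiv.ofLinearMap
      ((seqMap (Finsupp.domLCongr (R := R) (M := A) τ).toLinearMap).restrict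
        fun f hf => seqMap_mem_seqSpace (Finsupp.domLCongr τ).toLinearMap h1 hf)
      ((seqMap (Finsupp.domLCongr (R := R) (M := A) τ.symm).toLinearMap).restrict
        fun f hf => seqMap_mem_seqSpace (Finsupp.domLCongr τ.symm).toLinearMap h2 hf) ?_ ?_, ?_⟩
    · ext f n x
      simp [seqMap]
    · ext f n x
      simp [seqMap]
    · rintro v w h
      have := seqShift_seqMap (Finsupp.domLCongr (R := R) (M := A) τ).toLinearMap v.1
      rw [← h] at this
      exact this

end Code

/-! ### Coding structures by sets of labels -/

section Facts

variable {L : FirstOrder.Language.{0, 0}} (c : L.Symbols → ℕ)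

/-- The atomic facts of a structure, coded as labels. -/
def facts (M : Str L) : Set Label :=
  {u | (∃ (n : ℕ) (f : L.Functions n) (a : Fin n → ℕ) (b : ℕ),
      u = (c (.inl ⟨n, f⟩), b :: List.ofFn a) ∧ M.funMap f a = b) ∨
    ∃ (n : ℕ) (r : L.Relations n) (a : Fin n → ℕ),
      u = (c (.inr ⟨n, r⟩), List.ofFn a) ∧ M.RelMap r a}

variable {c}

theorem fun_mem_facts (hc : Function.Injective c) {M : Str L} {n : ℕ} {f : L.Functions n}
    {a : Fin n → ℕ} {b : ℕ} :
    ((c (.inl ⟨n, f⟩), b :: List.ofFn a) : Label) ∈ facts c M ↔ M.funMap f a = b := by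
  constructor
  · rintro (⟨n', f', a', b', h, h'⟩ | ⟨n', r', a', h, -⟩)
    · rw [Prod.mk.injEq] at h
      have h1 := hc h.1
      rw [Sum.inl.injEq, Sigma.mk.injEq] at h1
      obtain ⟨rfl, h1⟩ := h1
      obtain rfl := eq_of_heq h1
      have h2 := h.2
      rw [List.cons.injEq] at h2
      obtain rfl := List.ofFn_injective h2.2
      exact h'.trans h2.1.symm
    · rw [Prod.mk.injEq] at h
      exact absurd (hc h.1) (by simp)
  · intro h
    exact .inl ⟨n, f, a, b, rfl, h⟩

theorem rel_mem_facts (hc : Function.Injective c) {M : Str L} {n : ℕ} {r : L.Relations n}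
    {a : Fin n → ℕ} :
    ((c (.inr ⟨n, r⟩), List.ofFn a) : Label) ∈ facts c M ↔ M.RelMap r a := by
  constructor
  · rintro (⟨n', f', a', b', h, -⟩ | ⟨n', r', a', h, h'⟩)
    · rw [Prod.mk.injEq] at h
      exact absurd (hc h.1) (by simp)
    · rw [Prod.mk.injEq] at h
      have h1 := hc h.1
      rw [Sum.inr.injEq, Sigma.mk.injEq] at h1
      obtain ⟨rfl, h1⟩ := h1
      obtain rfl := eq_of_heq h1
      obtain rfl := List.ofFn_injective h.2
      exact h'
  · intro h
    exact .inr ⟨n, r, a, rfl, h⟩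

theorem iso_iff_exists_perm {L : FirstOrder.Language} {S S' : Str L} :
    Str.Iso S S' ↔ ∃ σ : Equiv.Perm ℕ,
      (∀ (n : ℕ) (f : L.Functions n) (a : Fin n → ℕ), σ (S.funMap f a) = S'.funMap f (σ ∘ a)) ∧
      ∀ (n : ℕ) (r : L.Relations n) (a : Fin n → ℕ), S'.RelMap r (σ ∘ a) ↔ S.RelMap r a := by
  constructor
  · rintro ⟨e⟩
    exact ⟨@FirstOrder.Language.Equiv.toEquiv L ℕ ℕ S S' e,
      fun _ f a => @FirstOrder.Language.Equiv.map_fun' L ℕ ℕ S S' e _ f a,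
      fun _ r a => @FirstOrder.Language.Equiv.map_rel' L ℕ ℕ S S' e _ r a⟩
  · rintro ⟨σ, h, h'⟩
    exact ⟨@FirstOrder.Language.Equiv.mk L ℕ ℕ S S' σ (fun {n} => h n) (fun {n} => h' n)⟩

theorem iso_iff_facts (hc : Function.Injective c) (M N : Str L) :
    Str.Iso M N ↔ ∃ σ : Equiv.Perm ℕ, ∀ u, u ∈ facts c M ↔ relabel σ u ∈ facts c N := by
  rw [iso_iff_exists_perm]
  refine exists_congr fun σ => ⟨fun ⟨hf, hr⟩ u => ⟨?_, ?_⟩,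
    fun hσ => ⟨fun n f a => ?_, fun n r a => ?_⟩⟩
  · rintro (⟨n, f, a, b, rfl, h⟩ | ⟨n, r, a, rfl, h⟩)
    · refine .inl ⟨n, f, σ ∘ a, σ b, by simp [relabel, List.map_ofFn], ?_⟩
      rw [← h, hf]
    · exact .inr ⟨n, r, σ ∘ a, by simp [relabel, List.map_ofFn], (hr n r a).2 h⟩
  · have hu : relabel σ.symm (relabel σ u) = u := by
      rw [relabel_relabel, σ.symm_comp_self]
      simp [relabel]
    rintro (⟨n, f, a, b, hab, h⟩ | ⟨n, r, a, hab, h⟩)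
    · refine .inl ⟨n, f, σ.symm ∘ a, σ.symm b, ?_, ?_⟩
      · rw [← hu, hab]
        simp [relabel, List.map_ofFn]
      · rw [← h, Equiv.eq_symm_apply, hf, ← Function.comp_assoc, σ.self_comp_symm, Function.id_comp]
    · refine .inr ⟨n, r, σ.symm ∘ a, ?_, ?_⟩
      · rw [← hu, hab]
        simp [relabel, List.map_ofFn]
      · rwa [← hr, ← Function.comp_assoc, σ.self_comp_symm, Function.id_comp]
  · have h := (hσ _).1 ((fun_mem_facts hc (M := M) (f := f) (a := a)).2 rfl)
    simp only [relabel, List.map_cons, List.map_ofFn] at h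
    exact ((fun_mem_facts hc).1 h).symm
  · have h := hσ (c (.inr ⟨n, r⟩), List.ofFn a)
    simp only [relabel, List.map_ofFn] at h
    rw [rel_mem_facts hc, rel_mem_facts hc] at h
    exact h.symm

theorem measurableSet_funMap {L : FirstOrder.Language} {n : ℕ} (f : L.Functions n)
    (a : Fin n → ℕ) (b : ℕ) :
    MeasurableSet {S : Str L | S.funMap f a = b} :=
  IsOpen.measurableSet (TopologicalSpace.isOpen_generateFrom_of_mem
    (.inl (.inl ⟨n, f, a, b, rfl⟩)))

theorem measurableSet_relMap {L : FirstOrder.Language} {n : ℕ} (r : L.Relations n) (a : Fin n → ℕ) :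
    MeasurableSet {S : Str L | S.RelMap r a} :=
  IsOpen.measurableSet (TopologicalSpace.isOpen_generateFrom_of_mem
    (.inl (.inr ⟨n, r, a, rfl⟩)))

theorem countable_functions {L : FirstOrder.Language} [Countable L.Symbols] (n : ℕ) :
    Countable (L.Functions n) :=
  Function.Injective.countable (f := fun f : L.Functions n => (.inl ⟨n, f⟩ : L.Symbols))
    fun f g h => by simpa using h

theorem countable_relations {L : FirstOrder.Language} [Countable L.Symbols] (n : ℕ) :
    Countable (L.Relations n) :=
  Function.Injective.countable (f := fun f : L.Relations n => (.inr ⟨n, f⟩ : L.Symbols))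
    fun f g h => by simpa using h

theorem measurableSet_exists {Ω ι : Type*} [MeasurableSpace Ω] [Countable ι] {p : ι → Ω → Prop}
    (h : ∀ i, MeasurableSet {ω | p i ω}) : MeasurableSet {ω | ∃ i, p i ω} := by
  rw [Set.ofPred_exists]
  exact MeasurableSet.iUnion h

theorem measurableSet_mem_facts [Countable L.Symbols] (u : Label) :
    MeasurableSet {M : Str L | u ∈ facts c M} := by
  have := countable_functions (L := L)
  have := countable_relations (L := L)
  refine MeasurableSet.union ?_ ?_
  · refine measurableSet_exists fun n => measurableSet_exists fun f =>
      measurableSet_exists fun a => measurableSet_exists fun b => ?_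
    exact (MeasurableSet.const _).inter (measurableSet_funMap f a b)
  · refine measurableSet_exists fun n => measurableSet_exists fun r =>
      measurableSet_exists fun a => ?_
    exact (MeasurableSet.const _).inter (measurableSet_relMap r a)

end Facts

/-! ### Enumerating subsets of a countable set -/

section Enum

-- Elements are numbered by counting the smaller codes in S. This explicit description of the
-- enumeration is what makes its dependence on S measurable.
open Classical in
theorem exists_enum {α : Type*} {e : α → ℕ} {S : Set α} (he : S.InjOn e) (hS : S.Infinite) :
    ∃ ε : ℕ ≃ S, ∀ n u, (ε n : α) = u ↔ u ∈ S ∧ Nat.count (fun m => m ∈ e '' S) (e u) = n := by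
  have hinf : (e '' S).Infinite := hS.image he
  have hbij : Function.Bijective fun v : S => Nat.count (fun m => m ∈ e '' S) (e v) := by
    refine ⟨fun v w h => Subtype.ext (he v.2 w.2 ?_), fun n => ?_⟩
    · exact Nat.count_injective (Set.mem_image_of_mem e v.2) (Set.mem_image_of_mem e w.2) h
    · obtain ⟨v, hv, hvn⟩ := Nat.nth_mem_of_infinite (p := fun m => m ∈ e '' S) hinf n
      refine ⟨⟨v, hv⟩, ?_⟩
      change Nat.count (fun m => m ∈ e '' S) (e v) = n
      rw [hvn]
      exact Nat.count_nth_of_infinite hinf n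
  refine ⟨(Equiv.ofBijective _ hbij).symm, fun n u => ⟨?_, ?_⟩⟩
  · rintro rfl
    exact ⟨Subtype.coe_prop _, (Equiv.ofBijective _ hbij).apply_symm_apply n⟩
  · rintro ⟨hu, rfl⟩
    exact congrArg Subtype.val ((Equiv.ofBijective _ hbij).symm_apply_apply ⟨u, hu⟩)

open Classical in
theorem measurable_count {Ω : Type*} [MeasurableSpace Ω] {P : Ω → ℕ → Prop}
    (hP : ∀ n, MeasurableSet {ω | P ω n}) (k : ℕ) : Measurable fun ω => Nat.count (P ω) k := by
  induction k with
  | zero => simp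
  | succ k ih =>
    simp only [Nat.count_succ]
    exact ih.add (Measurable.ite (hP k) measurable_const measurable_const)

/-- A measurable family of infinite subsets of a countable set can be enumerated measurably. -/
theorem exists_measurable_enum {Ω : Type*} [MeasurableSpace Ω] {α : Type*} {C : Set α}
    (hC : C.Countable) (S : Ω → Set α) (hSC : ∀ ω, S ω ⊆ C) (hS : ∀ ω, (S ω).Infinite)
    (hm : ∀ u, MeasurableSet {ω | u ∈ S ω}) :
    ∃ ε : ∀ ω, ℕ ≃ S ω, ∀ n u, MeasurableSet {ω | (ε ω n : α) = u} := by
  obtain ⟨e, he⟩ := Set.countable_iff_exists_injOn.1 hC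
  choose ε hε using fun ω => exists_enum (he.mono (hSC ω)) (hS ω)
  refine ⟨ε, fun n u => ?_⟩
  simp only [hε]
  refine (hm u).inter ?_
  have : ∀ m, MeasurableSet {ω | m ∈ e '' S ω} := fun m => by
    have h : {ω | m ∈ e '' S ω} = ⋃ v ∈ {v ∈ C | e v = m}, {ω | v ∈ S ω} := by
      ext ω
      simp only [Set.mem_ofPred_eq, Set.mem_image, Set.mem_iUnion, exists_prop]
      exact ⟨fun ⟨v, hv, h⟩ => ⟨v, ⟨hSC ω hv, h⟩, hv⟩, fun ⟨v, ⟨_, h⟩, hv⟩ => ⟨v, hv, h⟩⟩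
    rw [h]
    exact MeasurableSet.biUnion (hC.mono fun _ h => h.1) fun v _ => hm v
  exact measurable_count this (e u) (measurableSet_singleton n)

end Enum

/-! ### Modules with an endomorphism as structures on the natural numbers -/

section EndoStr

universe u

variable {R : Type u} [Ring R] {V : Type*} [AddCommGroup V] [Module R V]

/-- The structure on `ℕ` transported from a module with an endomorphism. -/
def endoStr (T : V →ₗ[R] V) (ε : ℕ ≃ V) : Str (endoLang R) where
  funMap {_} f := match f with
    | EndoFunc.zero => fun _ => ε.symm 0
    | EndoFunc.add => fun a => ε.symm (ε (a 0) + ε (a 1))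
    | EndoFunc.smul r => fun a => ε.symm (r • ε (a 0))
    | EndoFunc.endo => fun a => ε.symm (T (ε (a 0)))
  RelMap r := Empty.elim r

theorem realize_univClosure {L : FirstOrder.Language} {M : Type*} [L.Structure M] {n : ℕ}
    (φ : InfFormula L n) (y : Fin 0 → M) :
    (InfFormula.univClosure φ).Realize y ↔ ∀ x : Fin n → M, φ.Realize x := by
  induction n with
  | zero =>
    rw [InfFormula.univClosure]
    exact ⟨fun h x => Subsingleton.elim y x ▸ h, fun h => h y⟩
  | succ n ih =>
    rw [InfFormula.univClosure, ih]
    simp only [InfFormula.Realize]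
    exact ⟨fun h x => by simpa using h (Fin.init x) (x (Fin.last n)), fun h x a => h _⟩

theorem endoStr_mem (T : V →ₗ[R] V) (ε : ℕ ≃ V) : endoStr T ε ∈ Mod (endoTheory R) := by
  let : (endoLang R).Structure ℕ := endoStr T ε
  have hzero : ∀ {n} (x : Fin n → ℕ), (EndoTerm.zero : (endoLang R).Term (Fin n)).realize x =
    ε.symm 0 := fun _ => rfl
  have hadd : ∀ {n} (x : Fin n → ℕ) (s t : (endoLang R).Term (Fin n)),
    (EndoTerm.add s t).realize x = ε.symm (ε (s.realize x) + ε (t.realize x)) := fun _ _ _ => rfl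
  have hsmul : ∀ {n} (x : Fin n → ℕ) (r : R) (t : (endoLang R).Term (Fin n)),
    (EndoTerm.smul r t).realize x = ε.symm (r • ε (t.realize x)) := fun _ _ _ => rfl
  have hendo : ∀ {n} (x : Fin n → ℕ) (t : (endoLang R).Term (Fin n)),
    (EndoTerm.endo t).realize x = ε.symm (T (ε (t.realize x))) := fun _ _ => rfl
  have hx : ∀ {n} (x : Fin n → ℕ) (i : Fin n),
    (EndoTerm.x i : (endoLang R).Term (Fin n)).realize x = x i := fun _ _ => rfl
  intro φ hφ
  change φ.Realize (M := ℕ) Fin.elim0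
  cases hφ with
  | exists_neg =>
    rw [realize_univClosure]
    intro x h
    refine h (ε.symm (-ε (x 0))) ?_
    change _ = _
    have h0 : (Fin.snoc x (ε.symm (-ε (x 0))) : Fin 2 → ℕ) 0 = x 0 := rfl
    have h1 : (Fin.snoc x (ε.symm (-ε (x 0))) : Fin 2 → ℕ) 1 = ε.symm (-ε (x 0)) := rfl
    rw [hadd, hzero, hx, hx, h0, h1]
    simp
  | _ =>
    rw [realize_univClosure]
    intro x
    simp only [InfFormula.Realize, hzero, hadd, hsmul, hendo, hx, Equiv.apply_symm_apply, add_zero,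
      Equiv.symm_apply_apply, smul_add, add_smul, mul_smul, one_smul, map_add, map_smul,
      EmbeddingLike.apply_eq_iff_eq]
    try abel

theorem iso_endoStr_iff {V' : Type*} [AddCommGroup V'] [Module R V'] (T : V →ₗ[R] V) (ε : ℕ ≃ V)
    (T' : V' →ₗ[R] V') (ε' : ℕ ≃ V') :
    Str.Iso (endoStr T ε) (endoStr T' ε') ↔ ∃ φ : V ≃ₗ[R] V', ∀ v, φ (T v) = T' (φ v) := by
  rw [iso_iff_exists_perm]
  constructor
  · rintro ⟨e, hfun, -⟩
    have hadd : ∀ a b, e (ε.symm (ε a + ε b)) =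
        ε'.symm (ε' (e a) + ε' (e b)) := fun a b =>
      hfun _ (EndoFunc.add : (endoLang R).Functions 2) ![a, b]
    have hsmul : ∀ r a, e (ε.symm (r • ε a)) = ε'.symm (r • ε' (e a)) := fun r a =>
      hfun _ (EndoFunc.smul r : (endoLang R).Functions 1) ![a]
    have hendo : ∀ a, e (ε.symm (T (ε a))) = ε'.symm (T' (ε' (e a))) := fun a =>
      hfun _ (EndoFunc.endo : (endoLang R).Functions 1) ![a]
    refine ⟨{ toFun := fun v => ε' (e (ε.symm v))
              invFun := fun v => ε (e.symm (ε'.symm v))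
              left_inv := fun v => by simp
              right_inv := fun v => by simp
              map_add' := fun v w => ?_
              map_smul' := fun r v => ?_ }, fun v => ?_⟩
    · have := hadd (ε.symm v) (ε.symm w)
      simp only [Equiv.apply_symm_apply] at this
      rw [this, Equiv.apply_symm_apply]
    · have := hsmul r (ε.symm v)
      simp only [Equiv.apply_symm_apply] at this
      rw [this, Equiv.apply_symm_apply]
      rfl
    · have := hendo (ε.symm v)
      simp only [Equiv.apply_symm_apply] at this
      change ε' (e (ε.symm (T v))) = _
      rw [this, Equiv.apply_symm_apply]
      rfl
  · rintro ⟨φ, hφ⟩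
    refine ⟨(ε.trans φ.toEquiv).trans ε'.symm, ?_, ?_⟩
    · intro n f a
      cases f with
      | zero =>
        change ε'.symm (φ (ε (ε.symm 0))) = ε'.symm 0
        simp
      | add =>
        change ε'.symm (φ (ε (ε.symm (ε (a 0) + ε (a 1))))) =
          ε'.symm (ε' (ε'.symm (φ (ε (a 0)))) + ε' (ε'.symm (φ (ε (a 1)))))
        simp
      | smul r =>
        change ε'.symm (φ (ε (ε.symm (r • ε (a 0))))) = ε'.symm (r • ε' (ε'.symm (φ (ε (a 0)))))
        simp
      | endo =>
        change ε'.symm (φ (ε (ε.symm (T (ε (a 0)))))) = ε'.symm (T' (ε' (ε'.symm (φ (ε (a 0))))))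
        simp [hφ]
    · intro n r
      exact Empty.elim r

instance countable_symbols [Countable R] : Countable (endoLang R).Symbols := by
  have h : ∀ n, Countable (EndoFunc R n) := fun n => by
    refine Function.Injective.countable (β := Option (Option (Option R)))
      (f := fun f : EndoFunc R n => match n, f with
        | _, EndoFunc.zero => none
        | _, EndoFunc.add => some none
        | _, EndoFunc.endo => some (some none)
        | _, EndoFunc.smul r => some (some (some r))) ?_
    intro f g h
    cases f <;> cases g <;> simp_all
  have h' : Countable (Σ l, (endoLang R).Functions l) :=
    inferInstanceAs (Countable (Σ l, EndoFunc R l))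
  have h'' : Countable (Σ l, (endoLang R).Relations l) :=
    inferInstanceAs (Countable (Σ _ : ℕ, Empty))
  exact inferInstanceAs (Countable ((Σ l, (endoLang R).Functions l) ⊕
    (Σ l, (endoLang R).Relations l)))

end EndoStr

/-! ### Borel measurability of the encoding and the final reduction -/

section Measurability

/-- A countable language gives a countable subbasis, so the subbasic sets generate the Borel
σ-algebra. -/
theorem measurable_str {L : FirstOrder.Language} [Countable L.Symbols] {Ω : Type*}
    [MeasurableSpace Ω] {F : Ω → Str L}
    (hf : ∀ (n : ℕ) (f : L.Functions n) (a : Fin n → ℕ) (b : ℕ),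
      MeasurableSet {ω | (F ω).funMap f a = b})
    (hr : ∀ (n : ℕ) (r : L.Relations n) (a : Fin n → ℕ), MeasurableSet {ω | (F ω).RelMap r a}) :
    Measurable F := by
  have := countable_functions (L := L)
  have := countable_relations (L := L)
  have hc : ({U | ∃ (n : ℕ) (f : L.Functions n) (a : Fin n → ℕ) (b : ℕ),
        U = {S : Str L | S.funMap f a = b}} ∪
      {U | ∃ (n : ℕ) (r : L.Relations n) (a : Fin n → ℕ), U = {S : Str L | S.RelMap r a}} ∪
      {U | ∃ (n : ℕ) (r : L.Relations n) (a : Fin n → ℕ),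
        U = {S : Str L | ¬ S.RelMap r a}}).Countable := by
    refine ((?_ : Set.Countable _).union ?_).union ?_
    · refine (Set.countable_range fun p : Σ n, L.Functions n × (Fin n → ℕ) × ℕ =>
        {S : Str L | S.funMap p.2.1 p.2.2.1 = p.2.2.2}).mono ?_
      rintro U ⟨n, f, a, b, rfl⟩
      exact ⟨⟨n, f, a, b⟩, rfl⟩
    · refine (Set.countable_range fun p : Σ n, L.Relations n × (Fin n → ℕ) =>
        {S : Str L | S.RelMap p.2.1 p.2.2}).mono ?_
      rintro U ⟨n, r, a, rfl⟩
      exact ⟨⟨n, r, a⟩, rfl⟩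
    · refine (Set.countable_range fun p : Σ n, L.Relations n × (Fin n → ℕ) =>
        {S : Str L | ¬ S.RelMap p.2.1 p.2.2}).mono ?_
      rintro U ⟨n, r, a, rfl⟩
      exact ⟨⟨n, r, a⟩, rfl⟩
  have : SecondCountableTopology (Str L) := ⟨⟨_, hc, rfl⟩⟩
  refine (measurable_generateFrom ?_).mono le_rfl
    (borel_eq_generateFrom_of_subbasis (α := Str L) rfl).le
  rintro U ((⟨n, f, a, b, rfl⟩ | ⟨n, r, a, rfl⟩) | ⟨n, r, a, rfl⟩)
  · exact hf n f a b
  · exact hr n r a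
  · exact (hr n r a).compl

universe u

variable {R : Type u} [Ring R]

/-- All elements range over the countable set C, so each condition on an operation is a countable
union over the possible values of its arguments. -/
theorem measurable_endoStr [Countable R] {Ω X : Type*} [MeasurableSpace Ω] [AddCommGroup X]
    [Module R X] (T : X →ₗ[R] X) (S : Ω → Submodule R X) (hT : ∀ ω, ∀ x ∈ S ω, T x ∈ S ω)
    {C : Set X} (hC : C.Countable) (hSC : ∀ ω, (S ω : Set X) ⊆ C) (ε : ∀ ω, ℕ ≃ S ω)
    (hε : ∀ n u, MeasurableSet {ω | (ε ω n : X) = u}) :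
    Measurable fun ω => endoStr (T.restrict (hT ω)) (ε ω) := by
  have key : ∀ (G : X → X → X) (m n b : ℕ),
      MeasurableSet {ω | G (ε ω m : X) (ε ω n : X) = (ε ω b : X)} := by
    intro G m n b
    have : {ω | G (ε ω m : X) (ε ω n : X) = (ε ω b : X)} = ⋃ u ∈ C, ⋃ v ∈ C,
        {ω | (ε ω m : X) = u} ∩ ({ω | (ε ω n : X) = v} ∩ {ω | (ε ω b : X) = G u v}) := by
      ext ω
      simp only [Set.mem_ofPred_eq, Set.mem_iUnion, Set.mem_inter_iff, exists_prop]
      constructor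
      · intro h
        exact ⟨_, hSC ω (ε ω m).2, _, hSC ω (ε ω n).2, rfl, rfl, h.symm⟩
      · rintro ⟨u, -, v, -, rfl, rfl, h⟩
        exact h.symm
    rw [this]
    exact .biUnion hC fun u _ => .biUnion hC fun v _ => (hε m u).inter ((hε n v).inter (hε b _))
  refine measurable_str (fun n f a b => ?_) (fun n r => Empty.elim r)
  cases f with
  | zero =>
    convert key (fun _ _ => 0) 0 0 b using 3 with ω
    exact ((ε ω).symm_apply_eq).trans Subtype.ext_iff
  | add =>
    convert key (fun u v => u + v) (a 0) (a 1) b using 3 with ω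
    exact ((ε ω).symm_apply_eq).trans Subtype.ext_iff
  | smul r =>
    convert key (fun u _ => r • u) (a 0) (a 0) b using 3 with ω
    exact ((ε ω).symm_apply_eq).trans Subtype.ext_iff
  | endo =>
    convert key (fun u _ => T u) (a 0) (a 0) b using 3 with ω
    exact ((ε ω).symm_apply_eq).trans Subtype.ext_iff

variable {A : Type u} [AddCommGroup A] [Module R A] [IsSimpleModule R A] [Countable A]

/-- Only the summand with index 0 varies with ω. Membership in the sum asks for a splitting whose
first part ranges over a fixed countable set. -/
theorem measurableSet_mem_seqSpace_codeFamily {Ω : Type*} [MeasurableSpace Ω] {D : Ω → Set Label}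
    (hD : ∀ u, MeasurableSet {ω | u ∈ D ω}) (v : ℕ → Point →₀ A) :
    MeasurableSet {ω | v ∈ seqSpace (codeFamily R A (D ω))} := by
  have h0 : ∀ f : ℕ → Point →₀ A,
      MeasurableSet {ω | f ∈ fracSeq (euclidPoly 0) (codeFamily R A (D ω) 0)} := by
    intro f
    refine MeasurableSet.inter (s₁ := {ω | ∀ i, f i ∈ codeFamily R A (D ω) 0}) ?_ (.const _)
    rw [Set.ofPred_forall]
    refine .iInter fun i => ?_
    have : {ω | f i ∈ codeFamily R A (D ω) 0} =
        ⋂ x ∈ ((f i).support : Set Point), {ω | pointLabel x ∈ D ω} := by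
      ext ω
      simp only [Set.mem_iInter]
      exact Iff.rfl
    rw [this]
    exact .biInter (Set.to_countable _) fun x _ => hD _
  let E : Submodule R (ℕ → Point →₀ A) :=
    ⨆ n, fracSeq (euclidPoly (n + 1)) (codeFamily R A ∅ (n + 1))
  have hE : ∀ ω, seqSpace (codeFamily R A (D ω)) =
      fracSeq (euclidPoly 0) (codeFamily R A (D ω) 0) ⊔ E := fun ω => by
    have : ∀ n, codeFamily R A (D ω) (n + 1) = codeFamily R A ∅ (n + 1)
      | 0 => rfl
      | n + 1 => rfl
    rw [seqSpace, ← sup_iSup_nat_succ]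
    simp only [this, E]
  have : {ω | v ∈ seqSpace (codeFamily R A (D ω))} = ⋃ f ∈ (coprimeFrac (Point →₀ A) 1 : Set _),
      {ω | f ∈ fracSeq (euclidPoly 0) (codeFamily R A (D ω) 0)} ∩ {ω | v - f ∈ E} := by
    ext ω
    simp only [Set.mem_ofPred_eq, Set.mem_iUnion, Set.mem_inter_iff, exists_prop]
    constructor
    · intro h
      rw [hE, Submodule.mem_sup] at h
      obtain ⟨f, hf, g, hg, rfl⟩ := h
      exact ⟨f, seqSpace_le_coprimeFrac _ (fracSeq_le_seqSpace _ 0 hf), hf,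
        by rwa [add_sub_cancel_left]⟩
    · rintro ⟨f, -, hf, hg⟩
      rw [hE, Submodule.mem_sup]
      exact ⟨f, hf, _, hg, add_sub_cancel _ _⟩
  rw [this]
  exact .biUnion (countable_coprimeFrac _) fun f _ => (h0 f).inter (.const _)

theorem infinite_seqSpace_codeFamily (D : Set Label) :
    (seqSpace (codeFamily R A D) : Set (ℕ → Point →₀ A)).Infinite := by
  have := IsSimpleModule.nontrivial R A
  obtain ⟨a, ha⟩ := exists_ne (0 : A)
  refine Set.infinite_of_injective_forall_mem
    (f := fun n : ℕ => seqConst R (Point →₀ A) (Finsupp.single (basePoint (n, [])) a))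
    (fun m n h => ?_) fun n =>
      fracSeq_le_seqSpace _ 1 (seqConst_mem_fracSeq _ (K := codeFamily R A D 1) Submodule.mem_top)
  have h' := Finsupp.single_left_injective ha
    ((seqConst_zero (R := R) _).symm.trans ((congrFun h 0).trans (seqConst_zero _)))
  exact congrArg (fun x => (pointLabel x).1) h'

open EndoTerm InfFormula in
theorem countable_endoTheory [Countable R] : (endoTheory R).Countable := by
  refine ((Set.toFinite {
      univClosure (n := 3) (equal (add (add (x 0) (x 1)) (x 2)) (add (x 0) (add (x 1) (x 2)))),
      univClosure (n := 2) (equal (add (x 0) (x 1)) (add (x 1) (x 0))),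
      univClosure (n := 1) (equal (add (x 0) zero) (x 0)),
      univClosure (n := 1) (ex (n := 1) (equal (add (x 0) (x 1)) zero)),
      univClosure (n := 1) (equal (smul 1 (x 0)) (x 0)),
      univClosure (n := 2) (equal (endo (add (x 0) (x 1))) (add (endo (x 0)) (endo (x 1))))
      }).countable.union ((Set.countable_range fun r : R => univClosure (n := 2)
      (equal (smul r (add (x 0) (x 1))) (add (smul r (x 0)) (smul r (x 1))))).union
      ((Set.countable_range fun p : R × R => univClosure (n := 1)
      (equal (smul (p.1 + p.2) (x 0)) (add (smul p.1 (x 0)) (smul p.2 (x 0))))).union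
      ((Set.countable_range fun p : R × R => univClosure (n := 1)
      (equal (smul (p.1 * p.2) (x 0)) (smul p.1 (smul p.2 (x 0))))).union
      (Set.countable_range fun r : R => univClosure (n := 1)
      (equal (endo (smul r (x 0))) (smul r (endo (x 0))))))))).mono ?_
  rintro φ (_ | _ | _ | _ | r | ⟨r, s⟩ | ⟨r, s⟩ | _ | _ | r)
  · exact .inl (by simp)
  · exact .inl (by simp)
  · exact .inl (by simp)
  · exact .inl (by simp)
  · exact .inr (.inl ⟨r, rfl⟩)
  · exact .inr (.inr (.inl ⟨(r, s), rfl⟩))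
  · exact .inr (.inr (.inr (.inl ⟨(r, s), rfl⟩)))
  · exact .inl (by simp)
  · exact .inl (by simp)
  · exact .inr (.inr (.inr (.inr ⟨r, rfl⟩)))

variable (R) in
theorem exists_countable_simple [Nontrivial R] [Countable R] :
    ∃ m : Submodule R R, IsSimpleModule R (R ⧸ m) ∧ Countable (R ⧸ m) := by
  obtain ⟨m, hm⟩ := Ideal.exists_maximal R
  exact ⟨m, isSimpleModule_iff_isCoatom.2 hm.out, m.mkQ_surjective.countable⟩

variable (R) in
theorem borelReducible_endoTheory [Nontrivial R] [Countable R] {L : FirstOrder.Language.{0, 0}}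
    [Countable L.Symbols] (T : Set (InfSentence L)) : BorelReducible T (endoTheory R) := by
  obtain ⟨c, hc⟩ := exists_injective_nat L.Symbols
  obtain ⟨m, _, _⟩ := exists_countable_simple R
  let S : Mod T → Submodule R (ℕ → Point →₀ R ⧸ m) :=
    fun M => seqSpace (codeFamily R (R ⧸ m) (facts c M.1))
  have hC := countable_coprimeFrac (W := Point →₀ R ⧸ m) 1
  have hSC : ∀ M, (S M : Set (ℕ → Point →₀ R ⧸ m)) ⊆ coprimeFrac (Point →₀ R ⧸ m) 1 :=
    fun M _ => seqSpace_le_coprimeFrac _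
  have hT : ∀ M, ∀ v ∈ S M, seqShiftR R (Point →₀ R ⧸ m) v ∈ S M :=
    fun M v => seqShift_mem_seqSpace
  have hm : ∀ v, MeasurableSet {M | v ∈ S M} := fun v =>
    measurableSet_mem_seqSpace_codeFamily
      (fun u => measurable_subtype_coe (measurableSet_mem_facts u)) v
  obtain ⟨ε, hε⟩ := exists_measurable_enum hC (fun M => (S M : Set (ℕ → Point →₀ R ⧸ m))) hSC
    (fun M => infinite_seqSpace_codeFamily _) hm
  refine ⟨fun M => ⟨endoStr ((seqShiftR R (Point →₀ R ⧸ m)).restrict (hT M)) (ε M),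
    endoStr_mem _ _⟩, Measurable.subtype_mk (measurable_endoStr _ S hT hC hSC ε hε), fun M N => ?_⟩
  rw [iso_endoStr_iff, iso_iff_facts hc, ← seqSpace_codeFamily_equiv_iff R (R ⧸ m)]
  refine exists_congr fun φ => ⟨fun h v w hw => ?_, fun h v => Subtype.ext ?_⟩
  · have : w = (seqShiftR R (Point →₀ R ⧸ m)).restrict (hT M) v := Subtype.ext hw
    rw [this]
    exact congrArg Subtype.val (h v)
  · exact h v _ rfl

end Measurability

end BorelModules

theorem mainTheorem6 (R : Type*) [Ring R] [Nontrivial R] [Countable R] :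
    BorelModules.BorelComplete (BorelModules.endoTheory R) :=
  ⟨inferInstance, BorelModules.countable_endoTheory,
    fun _ T _ _ => BorelModules.borelReducible_endoTheory R T⟩
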